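/- Let $\mathfrak g$ be the Lie algebra of a reductive algebraic group $G$ over $\mathbb C$ (i.e. a finite-dimensional reductive complex Lie algebra), with a nondegenerate invariant symmetric bilinear form $(\cdot,\cdot)$, by which we identify $\mathfrak g\cong\mathfrak g^*$. Let $\{e,h,f\}$ be an $\mathfrak{sl}_2$-triple in $\mathfrak g$ with $e\neq 0$, so that $e$ is nilpotent, and let $\mathfrak g=\bigoplus_{i\in\mathbb Z}\mathfrak g_i$ be the decomposition into eigenspaces of $\mathrm{ad}_h$. An *MV slice* is an affine space $\mathcal M=e+C$, where $C\subset\mathfrak g$ is an $\mathrm{ad}_h$-stable subspace with $\mathfrak g=[\mathfrak g,e]\oplus C$. The group $\mathbb C^\times$ acts on $\mathfrak g$ by the Kazhdan action $\rho(t)x=t^{2}\,\mathrm{Ad}(\gamma(t^{-1}))x$, where $\gamma(t)$ is the image of $\mathrm{diag}(t,t^{-1})$ under the homomorphism $SL_2\to G$ given by the triple; thus $\rho(t)x=t^{2-i}x$ for $x\in\mathfrak g_i$. This action preserves every MV slice. Fix a Lagrangian subspace $\mathfrak l\subset\mathfrak g_{-1}$ for the form $\langle x,y\rangle=(e,[x,y])$.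 Put $\mathfrak m=\mathfrak l\oplus\bigoplus_{i\le -2}\mathfrak g_i$, and let $M\subset G$ be the unipotent subgroup with Lie algebra $\mathfrak m$, so that $\exp(y)\in M$ acts on $\mathfrak g$ by $e^{\mathrm{ad}\,y}$ for $y\in\mathfrak m$. Let $\mu:\mathfrak g\cong\mathfrak g^*\to\mathfrak m^*$ be the restriction map, and write $\mu^{-1}(e)=\{x\in\mathfrak g:(x,y)=(e,y)\ \forall y\in\mathfrak m\}=e+\mathfrak m^\perp$. Then: 1. Every MV slice $\mathcal M$ is contained in $\mu^{-1}(e)$ and carries a unique Poisson structure given by Hamiltonian reduction of the Kirillov–Kostant–Souriau Poisson structure on $\mathfrak g\cong\mathfrak g^*$. That is, restriction of functions is an isomorphism $(\mathbb C[\mathfrak g]/I(\mu^{-1}(e)))^M\to\mathbb C[\mathcal M]$; if $F,G\in\mathbb C[\mathfrak g]$ have $M$-invariant restrictions to $\mu^{-1}(e)$, then so does $\{F,G\}$; and the Poisson bracket on $\mathbb C[\mathcal M]$ is determined by $\{F|_{\mathcal M},G|_{\mathcal M}\}=\{F,G\}|_{\mathcal M}$ for all such $F,G$. 2. For any two MV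 slices $\mathcal M_1,\mathcal M_2$ for the same triple there is an isomorphism of algebraic varieties $\varphi:\mathcal M_1\to\mathcal M_2$ which is $\mathbb C^\times$-equivariant for the Kazhdan actions and an isomorphism of affine Poisson varieties for these Poisson structures. -/

import Mathlib

noncomputable section

namespace MVSlice

/-! ### Closed subvarieties of a vector space and their regular functions -/

/-- The algebra `ℂ[V]` of polynomial functions on a complex vector space `V`:
the algebra of functions generated by the linear functionals. -/
def polyFun (V : Type*) [AddCommGroup V] [Module ℂ V] : Subalgebra ℂ (V → ℂ) :=
  Algebra.adjoin ℂ (Set.range fun l : Module.Dual ℂ V => (l : V → ℂ))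

/-- Restriction of functions from `V` to a subset `X`. -/
def restrictHom {V : Type*} (X : Set V) : (V → ℂ) →ₐ[ℂ] (X → ℂ) where
  toFun F x := F x
  map_one' := rfl
  map_mul' _ _ := rfl
  map_zero' := rfl
  map_add' _ _ := rfl
  commutes' _ := rfl

/-- The coordinate ring `ℂ[X]` of a subset `X` of `V`: restrictions to `X` of polynomial
functions on `V`. -/
def coordRing {V : Type*} [AddCommGroup V] [Module ℂ V] (X : Set V) : Subalgebra ℂ (X → ℂ) :=
  (polyFun V).map (restrictHom X)

/-- The restriction map `ℂ[V] → ℂ[X]`. -/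
def res {V : Type*} [AddCommGroup V] [Module ℂ V] (X : Set V) (F : polyFun V) : coordRing X :=
  ⟨restrictHom X F, F, F.2, rfl⟩

/-- A morphism of varieties `X → Y`: a map along which regular functions pull back to
regular functions. -/
def IsRegularMap {V W : Type*} [AddCommGroup V] [Module ℂ V] [AddCommGroup W] [Module ℂ W]
    {X : Set V} {Y : Set W} (φ : X → Y) : Prop :=
  ∀ f ∈ coordRing Y, f ∘ φ ∈ coordRing X

/-- The pullback `φ^* : ℂ[Y] → ℂ[X]` along a morphism of varieties. -/
def pullback {V W : Type*} [AddCommGroup V] [Module ℂ V] [AddCommGroup W] [Module ℂ W]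
    {X : Set V} {Y : Set W} {φ : X → Y} (hφ : IsRegularMap φ) (f : coordRing Y) : coordRing X :=
  ⟨f ∘ φ, hφ f f.2⟩

/-- A Poisson bracket on a commutative `ℂ`-algebra. -/
structure PoissonBracket (A : Type*) [CommRing A] [Algebra ℂ A] where
  bracket : A →ₗ[ℂ] A →ₗ[ℂ] A
  bracket_self : ∀ a, bracket a a = 0
  jacobi : ∀ a b c,
    bracket a (bracket b c) + bracket b (bracket c a) + bracket c (bracket a b) = 0
  leibniz : ∀ a b c, bracket a (b * c) = bracket a b * c + b * bracket a c

/-- An isomorphism of affine Poisson varieties `(X, P) ≅ (Y, Q)`: an isomorphism of varieties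
whose pullback of functions intertwines the brackets. -/
structure IsPoissonIso {V W : Type*} [AddCommGroup V] [Module ℂ V] [AddCommGroup W] [Module ℂ W]
    {X : Set V} {Y : Set W} (P : PoissonBracket (coordRing X)) (Q : PoissonBracket (coordRing Y))
    (φ : X ≃ Y) : Prop where
  regular : IsRegularMap φ
  regular_symm : IsRegularMap φ.symm
  map_bracket : ∀ a b : coordRing Y,
    pullback regular (Q.bracket a b) = P.bracket (pullback regular a) (pullback regular b)

variable {𝔤 : Type*} [LieRing 𝔤] [LieAlgebra ℂ 𝔤] [FiniteDimensional ℂ 𝔤]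

/-! ### The Kirillov-Kostant-Souriau bracket on `𝔤 ≅ 𝔤^*` -/

/-- The gradient of `F` at `x` with respect to the nondegenerate form `κ`: for polynomial `F`, the
vector `v` such that `κ v w` is the derivative of `F` at `x` in the direction `w`, for all `w`. -/
def gradient (κ : LinearMap.BilinForm ℂ 𝔤) (hκ : κ.Nondegenerate) (F : 𝔤 → ℂ) (x : 𝔤) : 𝔤 :=
  ∑ i, lineDeriv ℂ F x (Module.finBasis ℂ 𝔤 i) • κ.dualBasis hκ (Module.finBasis ℂ 𝔤) i

/-- The Kirillov-Kostant-Souriau bracket, transported to `𝔤` by the isomorphism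
`x ↦ κ x` from `𝔤` to its dual. -/
def kksBracket (κ : LinearMap.BilinForm ℂ 𝔤) (hκ : κ.Nondegenerate) (F G : 𝔤 → ℂ) (x : 𝔤) : ℂ :=
  κ x ⁅gradient κ hκ F x, gradient κ hκ G x⁆

/-! ### Weight spaces and the Kazhdan action -/

/-- The weight space `𝔤_i`, the `i`-eigenspace of `ad h`. -/
def weightSpace (h : 𝔤) (i : ℤ) : Submodule ℂ 𝔤 :=
  (LieAlgebra.ad ℂ 𝔤 h).eigenspace (i : ℂ)

lemma isCompl_maxGenEigenspace {V : Type*} [AddCommGroup V] [Module ℂ V] [FiniteDimensional ℂ V]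
    (D : Module.End ℂ V) (c : ℂ) :
    IsCompl (D.maxGenEigenspace c) (⨆ (d : ℂ) (_ : d ≠ c), D.maxGenEigenspace d) := by
  refine ⟨D.independent_maxGenEigenspace c, ?_⟩
  rw [codisjoint_iff, eq_top_iff, ← Module.End.iSup_maxGenEigenspace_eq_top D]
  refine iSup_le fun d => ?_
  by_cases hd : d = c
  · subst hd
    exact le_sup_left
  · exact le_sup_of_le_right (le_iSup₂_of_le d hd le_rfl)

/-- The projection of `𝔤` onto its weight space of weight `i` along the other weight spaces. It is
written with generalized eigenspaces of `ad h`, which makes sense for every `h`; if `h` belongs to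
an `sl₂`-triple, then `ad h` is diagonalizable and these are the eigenspaces. -/
def weightProj (h : 𝔤) (i : ℤ) : 𝔤 →ₗ[ℂ] 𝔤 :=
  Submodule.projection _ _ (isCompl_maxGenEigenspace (LieAlgebra.ad ℂ 𝔤 h) (i : ℂ))

/-- `Ad γ(t)`, where `γ(t)` is the image of `diag(t, t⁻¹)` under the homomorphism from `SL₂` given
by an `sl₂`-triple with semisimple element `h`: multiplication by `t ^ i` on the weight space
of weight `i`, for all integers `i`. -/
def adGamma (h : 𝔤) (t : ℂˣ) : 𝔤 →ₗ[ℂ] 𝔤 :=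
  ∑ᶠ i : ℤ, ((t ^ i : ℂˣ) : ℂ) • weightProj h i

/-- The Kazhdan action `ρ(t) = t² Ad γ(t⁻¹)` on `𝔤`. -/
def kazhdan (h : 𝔤) (t : ℂˣ) : 𝔤 →ₗ[ℂ] 𝔤 :=
  ((t : ℂ) ^ 2) • adGamma h t⁻¹

/-- An MV slice for `(e, h)`: an affine space `e + C` with `C` stable under `ad h` and
`𝔤 = [𝔤, e] ⊕ C`. -/
def IsMVSlice (e h : 𝔤) (X : Set 𝔤) : Prop :=
  ∃ C : Submodule ℂ 𝔤, (∀ x ∈ C, ⁅h, x⁆ ∈ C) ∧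
    IsCompl (LinearMap.range (LieAlgebra.ad ℂ 𝔤 e)) C ∧ X = {x | x - e ∈ C}

lemma finite_support_weightProj (h : 𝔤) : {i : ℤ | weightProj h i ≠ 0}.Finite := by
  have h1 : {c : ℂ | (LieAlgebra.ad ℂ 𝔤 h).maxGenEigenspace c ≠ ⊥}.Finite :=
    WellFoundedGT.finite_ne_bot_of_iSupIndep
      (LieAlgebra.ad ℂ 𝔤 h).independent_maxGenEigenspace
  refine Set.Finite.subset (h1.preimage (f := fun i : ℤ => (i : ℂ))
    (fun a _ b _ hab => Int.cast_injective hab)) ?_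
  intro i hi hbot
  apply hi
  ext x
  have := Submodule.projection_apply_mem
    (isCompl_maxGenEigenspace (LieAlgebra.ad ℂ 𝔤 h) (i : ℂ)) x
  exact (Submodule.eq_bot_iff _).1 hbot _ this

lemma adGamma_apply (h : 𝔤) (t : ℂˣ) (x : 𝔤) :
    adGamma h t x = ∑ᶠ i : ℤ, ((t ^ i : ℂˣ) : ℂ) • weightProj h i x := by
  have hfin : (Function.support fun i : ℤ => ((t ^ i : ℂˣ) : ℂ) • weightProj h i).Finite := by
    refine (finite_support_weightProj h).subset fun i hi h0 => hi ?_
    simp only [h0, smul_zero]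
  exact ((LinearMap.applyₗ x : (𝔤 →ₗ[ℂ] 𝔤) →ₗ[ℂ] 𝔤).toAddMonoidHom.map_finsum hfin)

lemma weightProj_of_mem_ne (h : 𝔤) (i : ℤ) {c : ℂ} (hc : c ≠ i) {x : 𝔤}
    (hx : x ∈ (LieAlgebra.ad ℂ 𝔤 h).maxGenEigenspace c) : weightProj h i x = 0 := by
  refine (Submodule.projection_apply_eq_zero_iff _).2 ?_
  exact Submodule.mem_iSup_of_mem c (Submodule.mem_iSup_of_mem hc hx)

lemma adGamma_of_mem (h : 𝔤) (t : ℂˣ) (i : ℤ) {x : 𝔤}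
    (hx : x ∈ (LieAlgebra.ad ℂ 𝔤 h).maxGenEigenspace (i : ℂ)) :
    adGamma h t x = ((t ^ i : ℂˣ) : ℂ) • x := by
  rw [adGamma_apply, finsum_eq_single _ i]
  · congr 1
    exact Submodule.projection_apply_of_mem_left _ hx
  · intro j hj
    rw [weightProj_of_mem_ne h j (by exact_mod_cast hj.symm) hx, smul_zero]

lemma adGamma_mem (h : 𝔤) (t : ℂˣ) (C : Submodule ℂ 𝔤) (hC : ∀ x ∈ C, ⁅h, x⁆ ∈ C) {x : 𝔤}
    (hx : x ∈ C) : adGamma h t x ∈ C := by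
  have key := Submodule.eq_iSup_inf_genEigenspace (p := C) (f := LieAlgebra.ad ℂ 𝔤 h) ⊤
    (fun x hx => by simpa using hC x hx)
    (Module.End.iSup_maxGenEigenspace_eq_top (LieAlgebra.ad ℂ 𝔤 h))
  suffices C ≤ C.comap (adGamma h t) from this hx
  conv_lhs => rw [key]
  refine iSup_le fun c y hy => ?_
  obtain ⟨hy1, hy2⟩ := hy
  rw [Submodule.mem_comap]
  by_cases hc : ∃ i : ℤ, c = i
  · obtain ⟨i, rfl⟩ := hc
    rw [adGamma_of_mem h t i hy2]
    exact C.smul_mem _ hy1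
  · push Not at hc
    rw [adGamma_apply, finsum_eq_zero_of_forall_eq_zero]
    · exact C.zero_mem
    · intro i
      rw [weightProj_of_mem_ne h i (hc i) hy2, smul_zero]

/-- `ρ(t)` is multiplication by `t ^ (2 - i)` on the weight space of weight `i`. -/
lemma kazhdan_of_mem (h : 𝔤) (t : ℂˣ) (i : ℤ) {x : 𝔤} (hx : x ∈ weightSpace h i) :
    kazhdan h t x = ((t ^ (2 - i) : ℂˣ) : ℂ) • x := by
  have hx' : x ∈ (LieAlgebra.ad ℂ 𝔤 h).maxGenEigenspace (i : ℂ) :=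
    (Module.End.genEigenspace _ _).mono le_top hx
  rw [kazhdan, LinearMap.smul_apply, adGamma_of_mem h _ i hx', smul_smul]
  congr 1
  rw [zpow_sub, inv_zpow]
  push_cast
  rfl

/-- The Kazhdan action preserves every MV slice. -/
lemma kazhdan_mem {e h f : 𝔤} (ht : IsSl2Triple h e f) {X : Set 𝔤} (hX : IsMVSlice e h X)
    (t : ℂˣ) {x : 𝔤} (hx : x ∈ X) : kazhdan h t x ∈ X := by
  obtain ⟨C, hC, -, rfl⟩ := hX
  have he : kazhdan h t e = e := by
    rw [kazhdan_of_mem h t 2]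
    · simp
    · rw [weightSpace, Module.End.mem_eigenspace_iff]
      simp [ht.lie_h_e_nsmul, ofNat_smul_eq_nsmul]
  change kazhdan h t x - e ∈ C
  have hsub : kazhdan h t x - e = kazhdan h t (x - e) := by rw [map_sub, he]
  rw [hsub]
  exact C.smul_mem _ (adGamma_mem h _ C hC hx)

/-- The Kazhdan action on an MV slice. -/
def kazhdanOn {e h f : 𝔤} (ht : IsSl2Triple h e f) {X : Set 𝔤} (hX : IsMVSlice e h X)
    (t : ℂˣ) (x : X) : X :=
  ⟨kazhdan h t x, kazhdan_mem ht hX t x.2⟩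

/-! ### Hamiltonian reduction -/

/-- `𝔩` is a Lagrangian subspace of `𝔤_{-1}` for the form `⟨x, y⟩ = κ(e, [x, y])`. -/
def IsLagrangian (κ : LinearMap.BilinForm ℂ 𝔤) (e h : 𝔤) (𝔩 : Submodule ℂ 𝔤) : Prop :=
  𝔩 ≤ weightSpace h (-1) ∧
    ∀ x ∈ weightSpace h (-1), x ∈ 𝔩 ↔ ∀ y ∈ 𝔩, κ e ⁅x, y⁆ = 0

/-- The subspace `𝔪 = 𝔩 ⊕ ⨁_{i ≤ -2} 𝔤_i` (a nilpotent Lie subalgebra for `𝔩` Lagrangian). -/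
def nilp (h : 𝔤) (𝔩 : Submodule ℂ 𝔤) : Submodule ℂ 𝔤 :=
  𝔩 ⊔ ⨆ (i : ℤ) (_ : i ≤ -2), weightSpace h i

/-- The fibre `μ⁻¹(e)` through `e` of the moment map `𝔤 ≅ 𝔤^* → 𝔪^*`, `x ↦ κ(x, ·)|_𝔪`.
It is `e + 𝔪^⊥`. -/
def momentFiber (κ : LinearMap.BilinForm ℂ 𝔤) (e : 𝔤) (𝔪 : Submodule ℂ 𝔤) : Set 𝔤 :=
  {x | ∀ y ∈ 𝔪, κ x y = κ e y}

/-- `exp (ad y) = ∑ (ad y)^k / k!` for `ad y` nilpotent. -/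
def expAd (y : 𝔤) : 𝔤 →ₗ[ℂ] 𝔤 :=
  ∑ k ∈ Finset.range (nilpotencyClass (LieAlgebra.ad ℂ 𝔤 y)),
    ((k.factorial : ℂ)⁻¹) • (LieAlgebra.ad ℂ 𝔤 y) ^ k

/-- The restriction of `F` to `Z` is invariant under the adjoint action of the unipotent group
with Lie algebra `𝔪`, whose elements act on `𝔤` as `exp (ad y)` with `y ∈ 𝔪`. -/
def IsInvariantOn (𝔪 : Submodule ℂ 𝔤) (Z : Set 𝔤) (F : 𝔤 → ℂ) : Prop :=
  ∀ y ∈ 𝔪, ∀ x ∈ Z, F (expAd y x) = F x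

/-- `P` is the Poisson structure on `X ⊆ μ⁻¹(e)` obtained from `𝔤 ≅ 𝔤^*` by Hamiltonian reduction
with respect to the unipotent group `M` of `𝔪`: restriction of functions is an isomorphism from
`ℂ[μ⁻¹(e)]^M = (ℂ[𝔤] / I(μ⁻¹(e)))^M` onto `ℂ[X]`, and under it `P` is the bracket
`{F|, G|} = {F, G}|`, where `F, G ∈ ℂ[𝔤]` have `M`-invariant restrictions to `μ⁻¹(e)`. -/
structure IsHamiltonianReduction (κ : LinearMap.BilinForm ℂ 𝔤) (hκ : κ.Nondegenerate) (e : 𝔤)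
    (𝔪 : Submodule ℂ 𝔤) (X : Set 𝔤) (P : PoissonBracket (coordRing X)) : Prop where
  subset : X ⊆ momentFiber κ e 𝔪
  injective : ∀ F G : polyFun 𝔤, IsInvariantOn 𝔪 (momentFiber κ e 𝔪) F →
    IsInvariantOn 𝔪 (momentFiber κ e 𝔪) G → res X F = res X G →
    res (momentFiber κ e 𝔪) F = res (momentFiber κ e 𝔪) G
  surjective : ∀ a : coordRing X,
    ∃ F : polyFun 𝔤, IsInvariantOn 𝔪 (momentFiber κ e 𝔪) F ∧ res X F = a
  invariant_bracket : ∀ F G : polyFun 𝔤, IsInvariantOn 𝔪 (momentFiber κ e 𝔪) F →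
    IsInvariantOn 𝔪 (momentFiber κ e 𝔪) G →
    IsInvariantOn 𝔪 (momentFiber κ e 𝔪) (kksBracket κ hκ F G)
  bracket_eq : ∀ F G : polyFun 𝔤, IsInvariantOn 𝔪 (momentFiber κ e 𝔪) F →
    IsInvariantOn 𝔪 (momentFiber κ e 𝔪) G →
    ∀ x : X, (P.bracket (res X F) (res X G) : X → ℂ) x = kksBracket κ hκ F G x

end MVSlice

end

/-!
Write `Z = e + 𝔪^⊥` for the fibre of the moment map and `M` for the unipotent group of `𝔪`. All
claims follow once every MV slice `X = e + C` admits a polynomial retraction `π : Z → X` that is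
constant on `M`-orbits and moves each point inside its orbit (`IsSliceProjection`,
`exists_sliceProjection`); this is the statement that `X` is the quotient of `Z` by `M`.

Composition with `π` identifies `ℂ[X]` with the invariant functions on `Z`, as algebras. The bracket
of invariant functions is again invariant, because `M` acts by Poisson automorphisms, and on `Z` it
depends only on their restrictions to `Z`: the gradient of a function vanishing on `Z` lies in `𝔪`,
so its Hamiltonian vector field is tangent to the orbits (`kksBracket_eq_zero_of_vanish`,
`isInvariantOn_kksBracket`). This gives the reduced bracket on `ℂ[X]`. For two slices,
`π₂` restricted to `X₁` and `π₁` restricted to `X₂` are mutually inverse, since both move points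
inside orbits. They respect the brackets because invariant functions on `Z` restrict to
corresponding functions on the two slices. They are equivariant because the Kazhdan action permutes
the orbits.

To construct `π`, use the grading by `ad h`. By `sl₂`-theory `ad h` is diagonalizable with integer
eigenvalues (`iSup_eigenspace_eq_top`), and `ad e` is injective on negative weights. By duality
with respect to the form, positive weights lie in the image of `ad e`. Hence `C` has weights at most
`0`, and `𝔪^⊥ = [𝔪, e] ⊕ C` compatibly with weights (`exists_decomp`). A point of `Z` is then moved
into `X` by removing its coordinates along `[𝔪, e]` one at a time, from the highest weight
downwards, each by some `x ↦ exp (-ℓ(x - e) ad y) x` with `ℓ` linear (`exists_gaugeMap_of_le`).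
Constancy on orbits is checked infinitesimally, which avoids the Baker-Campbell-Hausdorff formula:
since each step involves multiples of one `y` only, its derivative maps `[𝔪, x]` into `[𝔪, x']`,
where `x'` is the image of `x`. For `π` the derivative also takes values in `C`, and `[𝔪, x']` meets
`C` trivially for `x'` in the slice (`IsGaugeMap.map_expAd`).
-/

noncomputable section

namespace MVSlice

/-! ### Differential calculus of polynomial functions -/

section PolynomialCalculus

variable {V : Type*} [AddCommGroup V] [Module ℂ V]

lemma dual_mem_polyFun (l : Module.Dual ℂ V) : (fun x => l x) ∈ polyFun V :=
  Algebra.subset_adjoin ⟨l, rfl⟩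

lemma const_mem_polyFun (c : ℂ) : (fun _ : V => c) ∈ polyFun V :=
  (polyFun V).algebraMap_mem c

/-- A self-map of a vector space is polynomial if it pulls polynomial functions back to
polynomial functions. -/
def IsPolyMap (E : V → V) : Prop := ∀ F ∈ polyFun V, (fun x => F (E x)) ∈ polyFun V

lemma IsPolyMap.of_dual {E : V → V}
    (hE : ∀ l : Module.Dual ℂ V, (fun x => l (E x)) ∈ polyFun V) : IsPolyMap E := by
  intro F hF
  induction hF using Algebra.adjoin_induction with
  | mem F hF =>
    obtain ⟨l, rfl⟩ := hF
    exact hE l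
  | algebraMap c => exact const_mem_polyFun c
  | add F G _ _ hF hG => exact add_mem hF hG
  | mul F G _ _ hF hG => exact mul_mem hF hG

lemma IsPolyMap.comp {E E' : V → V} (hE : IsPolyMap E) (hE' : IsPolyMap E') :
    IsPolyMap (fun x => E (E' x)) :=
  fun F hF => hE' _ (hE F hF)

lemma isPolyMap_affine (A : V →ₗ[ℂ] V) (v : V) : IsPolyMap fun x => A x + v :=
  .of_dual fun l => by
    simp only [map_add]
    exact add_mem (dual_mem_polyFun (l ∘ₗ A)) (const_mem_polyFun (l v))

/-- The curve `c` has velocity `v` at time `t`. Derivatives are tested on linear functionals, so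
that no topology on `V` is needed. -/
def HasVelocity (c : ℂ → V) (v : V) (t : ℂ) : Prop :=
  ∀ l : Module.Dual ℂ V, HasDerivAt (fun s => l (c s)) (l v) t

lemma hasVelocity_line (x v : V) : HasVelocity (fun t : ℂ => x + t • v) v 0 := fun l => by
  simpa using ((hasDerivAt_id (0 : ℂ)).mul_const (l v)).const_add (l x)

/-- A polynomial function has at each point a linear differential, which computes its derivative
along every curve through that point. -/
lemma exists_differential {F : V → ℂ} (hF : F ∈ polyFun V) (p : V) :
    ∃ d : Module.Dual ℂ V, ∀ (c : ℂ → V) (v : V) (t : ℂ), c t = p → HasVelocity c v t →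
      HasDerivAt (fun s => F (c s)) (d v) t := by
  induction hF using Algebra.adjoin_induction with
  | mem F hF =>
    obtain ⟨l, rfl⟩ := hF
    exact ⟨l, fun c v t _ hc => hc l⟩
  | algebraMap a =>
    exact ⟨0, fun c v t _ hc => by simpa using hasDerivAt_const t a⟩
  | add F G _ _ hF hG =>
    obtain ⟨d, hd⟩ := hF
    obtain ⟨d', hd'⟩ := hG
    exact ⟨d + d', fun c v t h hc => (hd c v t h hc).add (hd' c v t h hc)⟩
  | mul F G _ _ hF hG =>
    obtain ⟨d, hd⟩ := hF
    obtain ⟨d', hd'⟩ := hG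
    refine ⟨G p • d + F p • d', fun c v t h hc => ?_⟩
    subst h
    refine ((hd c v t rfl hc).mul (hd' c v t rfl hc)).congr_deriv ?_
    simp only [LinearMap.add_apply, LinearMap.smul_apply, smul_eq_mul]
    ring

/-- The chain rule for a polynomial function along a curve. -/
lemma HasVelocity.hasDerivAt {c : ℂ → V} {v : V} {t : ℂ} (hc : HasVelocity c v t) {F : V → ℂ}
    (hF : F ∈ polyFun V) : HasDerivAt (fun s => F (c s)) (lineDeriv ℂ F (c t) v) t := by
  obtain ⟨d, hd⟩ := exists_differential hF (c t)
  have h : lineDeriv ℂ F (c t) v = d v :=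
    (hd _ v 0 (by simp) (hasVelocity_line (c t) v)).deriv
  rw [h]
  exact hd c v t rfl hc

lemma hasLineDerivAt {F : V → ℂ} (hF : F ∈ polyFun V) (x v : V) :
    HasLineDerivAt ℂ F (lineDeriv ℂ F x v) x v := by
  have := (hasVelocity_line x v).hasDerivAt hF
  rw [zero_smul, add_zero] at this
  exact this

lemma exists_dual_eq_lineDeriv {F : V → ℂ} (hF : F ∈ polyFun V) (p : V) :
    ∃ d : Module.Dual ℂ V, ∀ v, lineDeriv ℂ F p v = d v := by
  obtain ⟨d, hd⟩ := exists_differential hF p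
  exact ⟨d, fun v => (hd _ v 0 (by simp) (hasVelocity_line p v)).deriv⟩

lemma lineDeriv_dual (l : Module.Dual ℂ V) (x v : V) : lineDeriv ℂ (fun y => l y) x v = l v :=
  (hasVelocity_line x v l).deriv

lemma lineDeriv_add' {F G : V → ℂ} (hF : F ∈ polyFun V) (hG : G ∈ polyFun V) (x v : V) :
    lineDeriv ℂ (F + G) x v = lineDeriv ℂ F x v + lineDeriv ℂ G x v :=
  (HasDerivAt.add (hasLineDerivAt hF x v) (hasLineDerivAt hG x v)).deriv

lemma lineDeriv_smul' (a : ℂ) {F : V → ℂ} (hF : F ∈ polyFun V) (x v : V) :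
    lineDeriv ℂ (a • F) x v = a * lineDeriv ℂ F x v :=
  (HasDerivAt.const_mul a (hasLineDerivAt hF x v)).deriv

lemma lineDeriv_mul' {F G : V → ℂ} (hF : F ∈ polyFun V) (hG : G ∈ polyFun V) (x v : V) :
    lineDeriv ℂ (F * G) x v = lineDeriv ℂ F x v * G x + F x * lineDeriv ℂ G x v := by
  have := (HasDerivAt.mul (hasLineDerivAt hF x v) (hasLineDerivAt hG x v)).deriv
  rw [zero_smul, add_zero] at this
  exact this

lemma lineDeriv_mem_polyFun {F : V → ℂ} (hF : F ∈ polyFun V) (v : V) :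
    (fun x => lineDeriv ℂ F x v) ∈ polyFun V := by
  induction hF using Algebra.adjoin_induction with
  | mem F hF =>
    obtain ⟨l, rfl⟩ := hF
    simp only [lineDeriv_dual]
    exact const_mem_polyFun _
  | algebraMap a =>
    have h : (fun x => lineDeriv ℂ (algebraMap ℂ (V → ℂ) a) x v) = fun _ => 0 := by
      funext x
      exact (hasDerivAt_const (0 : ℂ) a).deriv
    rw [h]
    exact const_mem_polyFun 0
  | add F G hF' hG' hF hG =>
    simp only [lineDeriv_add' hF' hG']
    exact add_mem hF hG
  | mul F G hF' hG' hF hG =>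
    simp only [lineDeriv_mul' hF' hG']
    exact add_mem (mul_mem hF hG') (mul_mem hF' hG)

end PolynomialCalculus

/-! ### The Kirillov-Kostant-Souriau bracket -/

section Kirillov

variable {𝔤 : Type*} [LieRing 𝔤] [LieAlgebra ℂ 𝔤] [FiniteDimensional ℂ 𝔤]
  (κ : LinearMap.BilinForm ℂ 𝔤) (hκ : κ.Nondegenerate)

/-- The defining property of the gradient. -/
lemma gradient_spec {F : 𝔤 → ℂ} (hF : F ∈ polyFun 𝔤) (x w : 𝔤) :
    κ (gradient κ hκ F x) w = lineDeriv ℂ F x w := by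
  obtain ⟨d, hd⟩ := exists_dual_eq_lineDeriv hF x
  have h : κ (gradient κ hκ F x) = d := by
    refine (Module.finBasis ℂ 𝔤).ext fun j => ?_
    simp [gradient, LinearMap.BilinForm.apply_dualBasis_left, hd]
  rw [h, hd]

lemma eq_gradient {F : 𝔤 → ℂ} (hF : F ∈ polyFun 𝔤) {x v : 𝔤}
    (hv : ∀ w, κ v w = lineDeriv ℂ F x w) : gradient κ hκ F x = v := by
  refine LinearMap.ker_eq_bot.1 hκ.ker_eq_bot (LinearMap.ext fun w => ?_)
  rw [gradient_spec κ hκ hF, hv]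

lemma gradient_dual (a x : 𝔤) : gradient κ hκ (fun y => κ a y) x = a :=
  eq_gradient κ hκ (dual_mem_polyFun (κ a)) fun w => (lineDeriv_dual (κ a) x w).symm

lemma gradient_add {F G : 𝔤 → ℂ} (hF : F ∈ polyFun 𝔤) (hG : G ∈ polyFun 𝔤) (x : 𝔤) :
    gradient κ hκ (F + G) x = gradient κ hκ F x + gradient κ hκ G x := by
  simp [gradient, lineDeriv_add' hF hG, add_smul, Finset.sum_add_distrib]

lemma gradient_smul (a : ℂ) {F : 𝔤 → ℂ} (hF : F ∈ polyFun 𝔤) (x : 𝔤) :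
    gradient κ hκ (a • F) x = a • gradient κ hκ F x := by
  simp [gradient, lineDeriv_smul' a hF, mul_smul, Finset.smul_sum]

lemma gradient_mul {F G : 𝔤 → ℂ} (hF : F ∈ polyFun 𝔤) (hG : G ∈ polyFun 𝔤) (x : 𝔤) :
    gradient κ hκ (F * G) x = G x • gradient κ hκ F x + F x • gradient κ hκ G x := by
  simp [gradient, lineDeriv_mul' hF hG, add_smul, mul_smul, Finset.sum_add_distrib,
    Finset.smul_sum, smul_comm (G x)]

lemma kksBracket_mem_polyFun {F G : 𝔤 → ℂ} (hF : F ∈ polyFun 𝔤) (hG : G ∈ polyFun 𝔤) :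
    kksBracket κ hκ F G ∈ polyFun 𝔤 := by
  have h : kksBracket κ hκ F G = ∑ i, ∑ j,
      (fun x => lineDeriv ℂ F x (Module.finBasis ℂ 𝔤 i)) *
      (fun x => lineDeriv ℂ G x (Module.finBasis ℂ 𝔤 j)) *
      (fun x => LinearMap.flip κ ⁅κ.dualBasis hκ (Module.finBasis ℂ 𝔤) i,
        κ.dualBasis hκ (Module.finBasis ℂ 𝔤) j⁆ x) := by
    funext x
    simp only [kksBracket, gradient, sum_lie, lie_sum, map_sum, Finset.sum_apply,
      smul_lie, lie_smul, map_smul, smul_eq_mul, Pi.mul_apply, LinearMap.flip_apply, mul_assoc]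
    simp only [Finset.mul_sum]
    rw [Finset.sum_comm]
    exact Finset.sum_congr rfl fun i _ => Finset.sum_congr rfl fun j _ => mul_left_comm _ _ _
  rw [h]
  exact sum_mem fun i _ => sum_mem fun j _ =>
    mul_mem (mul_mem (lineDeriv_mem_polyFun hF _) (lineDeriv_mem_polyFun hG _)) (dual_mem_polyFun _)

/-- The Kirillov-Kostant-Souriau bracket as a bilinear map on `ℂ[𝔤]`. -/
def kks : polyFun 𝔤 →ₗ[ℂ] polyFun 𝔤 →ₗ[ℂ] polyFun 𝔤 :=
  LinearMap.mk₂ ℂ (fun F G => ⟨kksBracket κ hκ F G, kksBracket_mem_polyFun κ hκ F.2 G.2⟩)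
    (fun F F' G => Subtype.ext <| funext fun x => by
      simp [kksBracket, gradient_add κ hκ F.2 F'.2])
    (fun a F G => Subtype.ext <| funext fun x => by
      simp [kksBracket, gradient_smul κ hκ a F.2])
    (fun F G G' => Subtype.ext <| funext fun x => by
      simp [kksBracket, gradient_add κ hκ G.2 G'.2])
    (fun a F G => Subtype.ext <| funext fun x => by
      simp [kksBracket, gradient_smul κ hκ a G.2])

lemma kks_apply (F G : polyFun 𝔤) (x : 𝔤) : (kks κ hκ F G : 𝔤 → ℂ) x = kksBracket κ hκ F G x :=
  rfl

lemma kks_self (F : polyFun 𝔤) : kks κ hκ F F = 0 :=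
  Subtype.ext <| funext fun x => by simp [kks_apply, kksBracket]

lemma kks_mul (F G H : polyFun 𝔤) : kks κ hκ F (G * H) = kks κ hκ F G * H + G * kks κ hκ F H :=
  Subtype.ext <| funext fun x => by
    simp [kks_apply, kksBracket, gradient_mul κ hκ G.2 H.2, mul_comm]

/-- For an alternating biderivation of an algebra, the Jacobi identity holds if it holds on
generators, since the Jacobiator is a derivation in each of its arguments. -/
lemma jacobi_of_generators {A : Type*} [CommRing A] [Algebra ℂ A] (B : A →ₗ[ℂ] A →ₗ[ℂ] A)
    (hself : ∀ a, B a a = 0) (hmul : ∀ a b c, B a (b * c) = B a b * c + b * B a c)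
    {S : Set A} (hS : Algebra.adjoin ℂ S = ⊤)
    (hJ : ∀ a ∈ S, ∀ b ∈ S, ∀ c ∈ S, B a (B b c) + B b (B c a) + B c (B a b) = 0) (a b c : A) :
    B a (B b c) + B b (B c a) + B c (B a b) = 0 := by
  have hskew : ∀ a b, B a b = - B b a := fun a b => by
    have := hself (a + b)
    simp only [map_add, LinearMap.add_apply, hself, zero_add, add_zero] at this
    exact eq_neg_of_add_eq_zero_right this
  have hone : ∀ a (r : ℂ), B a (algebraMap ℂ A r) = 0 := fun a r => by
    have h1 : B a 1 = 0 := by simpa using hmul a 1 1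
    rw [Algebra.algebraMap_eq_smul_one, map_smul, h1, smul_zero]
  -- It suffices to treat one argument, by cyclic symmetry.
  have key : ∀ b c, (∀ a ∈ S, B a (B b c) + B b (B c a) + B c (B a b) = 0) →
      ∀ a, B a (B b c) + B b (B c a) + B c (B a b) = 0 := by
    intro b c h a
    have ha : a ∈ Algebra.adjoin ℂ S := hS ▸ Algebra.mem_top
    induction ha using Algebra.adjoin_induction with
    | mem a ha => exact h a ha
    | algebraMap r =>
      rw [hskew (algebraMap ℂ A r) (B b c), hskew (algebraMap ℂ A r) b]
      simp [hone]
    | add x y _ _ hx hy =>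
      simp only [map_add, LinearMap.add_apply]
      linear_combination hx + hy
    | mul x y _ _ hx hy =>
      have e1 := hmul (B b c) x y
      rw [hskew (x * y) (B b c), hskew (x * y) b, hmul, hmul, hmul]
      rw [hskew x (B b c), hskew x b] at hx
      rw [hskew y (B b c), hskew y b] at hy
      simp only [map_add, map_neg, hmul] at hx hy ⊢
      linear_combination y * hx + x * hy
  have hcyc : ∀ {a b c}, B a (B b c) + B b (B c a) + B c (B a b) = 0 →
      B b (B c a) + B c (B a b) + B a (B b c) = 0 := fun h => by
    linear_combination h
  exact key b c (fun a ha => hcyc (hcyc (key c a (fun b hb => hcyc (hcyc (key a b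
    (fun c hc => hcyc (hcyc (hJ a ha b hb c hc))) c))) b))) a

lemma kks_jacobi (hκ_symm : κ.IsSymm) (F G H : polyFun 𝔤) :
    kks κ hκ F (kks κ hκ G H) + kks κ hκ G (kks κ hκ H F) + kks κ hκ H (kks κ hκ F G) = 0 := by
  set lin : 𝔤 → polyFun 𝔤 := fun a => ⟨fun y => κ a y, dual_mem_polyFun (κ a)⟩ with hlin
  have hbr : ∀ a b, kks κ hκ (lin a) (lin b) = lin ⁅a, b⁆ := fun a b =>
    Subtype.ext <| funext fun x => by
      simp only [kks_apply, kksBracket, hlin, gradient_dual]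
      exact hκ_symm.eq _ _
  refine jacobi_of_generators (kks κ hκ) (kks_self κ hκ) (kks_mul κ hκ) (S := Set.range lin) ?_ ?_
    F G H
  · have h : (Subtype.val '' Set.range lin) =
        Set.range fun l : Module.Dual ℂ 𝔤 => (l : 𝔤 → ℂ) := by
      ext F
      constructor
      · rintro ⟨_, ⟨a, rfl⟩, rfl⟩
        exact ⟨κ a, rfl⟩
      · rintro ⟨l, rfl⟩
        refine ⟨_, ⟨(κ.toDual hκ).symm l, rfl⟩, ?_⟩
        funext y
        simp [hlin]
    apply Subalgebra.map_injective (f := (polyFun 𝔤).val) Subtype.val_injective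
    rw [AlgHom.map_adjoin, Algebra.map_top, Subalgebra.range_val]
    exact congrArg (Algebra.adjoin ℂ) h
  · rintro _ ⟨a, rfl⟩ _ ⟨b, rfl⟩ _ ⟨c, rfl⟩
    simp only [hbr]
    refine Subtype.ext <| funext fun x => ?_
    have := congrArg (fun z => κ z x) (lie_jacobi a b c)
    simpa [hlin] using this

end Kirillov

/-! ### Weights of an `sl₂`-triple -/

section SlTwo

open Polynomial

variable {V : Type*} [AddCommGroup V] [Module ℂ V] [FiniteDimensional ℂ V]

/-- An operator shifting the eigenvalues of another operator by a nonzero constant is nilpotent: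
its nonzero powers would be eigenvectors of the commutator with distinct eigenvalues. -/
lemma isNilpotent_of_shift {H A : Module.End ℂ V} {c : ℂ} (hc : c ≠ 0)
    (h : H * A = A * H + c • A) : IsNilpotent A := by
  by_contra hA
  have hA' : ∀ k : ℕ, A ^ k ≠ 0 := fun k hk => hA ⟨k, hk⟩
  set T : Module.End ℂ (Module.End ℂ V) := LinearMap.mulLeft ℂ H - LinearMap.mulRight ℂ H with hT
  have hpow : ∀ k : ℕ, T (A ^ k) = (k * c) • A ^ k := by
    intro k
    induction k with
    | zero => simp [hT]
    | succ k ih =>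
      simp only [hT, LinearMap.sub_apply, LinearMap.mulLeft_apply, LinearMap.mulRight_apply] at ih ⊢
      have h1 : H * A ^ k = A ^ k * H + (k * c) • A ^ k := by rw [← ih]; abel
      rw [pow_succ, ← mul_assoc, h1, add_mul, mul_assoc, h]
      simp only [mul_add, mul_smul_comm, smul_mul_assoc, Nat.cast_add, Nat.cast_one, add_mul,
        one_mul, add_smul, mul_assoc]
      abel
  have hinj : Function.Injective fun k : ℕ => (k : ℂ) * c := fun a b hab => by
    simpa [hc] using hab
  refine Set.infinite_range_of_injective hinj (T.finite_hasEigenvalue.subset ?_)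
  rintro _ ⟨k, rfl⟩
  exact Module.End.hasEigenvalue_of_hasEigenvector
    (Module.End.hasEigenvector_iff.2 ⟨Module.End.mem_eigenspace_iff.2 (hpow k), hA' k⟩)

omit [FiniteDimensional ℂ V] in
lemma aeval_X_sub_C_apply (H : Module.End ℂ V) (a : ℂ) (v : V) :
    aeval H (X - C a) v = H v - a • v := by
  simp only [map_sub, aeval_X, aeval_C, LinearMap.sub_apply, Module.algebraMap_end_apply]

omit [FiniteDimensional ℂ V] in
lemma mem_iSup_eigenspace_of_prod (H : Module.End ℂ V) {a : ℕ → ℤ} (ha : Function.Injective a)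
    (m : ℕ) (v : V) (hv : (aeval H (∏ i ∈ Finset.range m, (X - C (a i : ℂ)))) v = 0) :
    v ∈ ⨆ i : ℤ, H.eigenspace (i : ℂ) := by
  induction m generalizing v with
  | zero =>
    have : v = 0 := by simpa using hv
    simp [this]
  | succ m ih =>
    rw [Finset.prod_range_succ] at hv
    have hcop : IsCoprime (∏ i ∈ Finset.range m, (X - C (a i : ℂ))) (X - C (a m : ℂ)) := by
      refine IsCoprime.prod_left fun i hi => isCoprime_X_sub_C_of_isUnit_sub ?_
      have : (a i : ℂ) - a m ≠ 0 := by
        rw [sub_ne_zero]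
        exact_mod_cast fun h => (Finset.mem_range.1 hi).ne (ha h)
      exact this.isUnit
    have hv' : v ∈ LinearMap.ker (aeval H ((∏ i ∈ Finset.range m, (X - C (a i : ℂ))) *
        (X - C (a m : ℂ)))) := hv
    rw [← sup_ker_aeval_eq_ker_aeval_mul_of_coprime H hcop, Submodule.mem_sup] at hv'
    obtain ⟨x, hx, y, hy, rfl⟩ := hv'
    refine add_mem (ih x hx) (Submodule.mem_iSup_of_mem (a m) ?_)
    rw [Module.End.mem_eigenspace_iff]
    have hy' : aeval H (X - C (a m : ℂ)) y = 0 := hy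
    rwa [aeval_X_sub_C_apply, sub_eq_zero] at hy'

variable {H E F : Module.End ℂ V}

omit [FiniteDimensional ℂ V] in
lemma e_mul_f_pow (hHF : H * F = F * H - (2 : ℂ) • F) (hEF : E * F = F * E + H) (k : ℕ) :
    E * F ^ (k + 1) = F ^ (k + 1) * E + ((k : ℂ) + 1) • (F ^ k * (H - (k : ℂ) • 1)) := by
  induction k with
  | zero => simp [hEF]
  | succ k ih =>
    rw [pow_succ, ← mul_assoc, ih, add_mul, smul_mul_assoc, mul_assoc, hEF, mul_assoc (F ^ k),
      sub_mul, hHF]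
    simp only [pow_succ, mul_sub, mul_add, smul_mul_assoc, one_mul, mul_one, mul_smul_comm,
      smul_sub, mul_assoc, Nat.cast_add, Nat.cast_one]
    module

omit [FiniteDimensional ℂ V] in
/-- On vectors killed by `E`, vanishing of `F ^ k` bounds the possible weights. -/
lemma prod_apply_of_f_pow (hHE : H * E = E * H + (2 : ℂ) • E)
    (hHF : H * F = F * H - (2 : ℂ) • F) (hEF : E * F = F * E + H) (k : ℕ) (v : V) (hE : E v = 0)
    (hF : (F ^ k) v = 0) : aeval H (∏ j ∈ Finset.range k, (X - C (j : ℂ))) v = 0 := by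
  induction k generalizing v with
  | zero => simpa using hF
  | succ k ih =>
    have hEH : E (H v) = 0 := by
      have := LinearMap.congr_fun hHE v
      simpa [hE] using this.symm
    rw [Finset.prod_range_succ, map_mul, Module.End.mul_apply, aeval_X_sub_C_apply]
    apply ih
    · simp [hE, hEH]
    · have := LinearMap.congr_fun (e_mul_f_pow hHF hEF k) v
      simp only [Module.End.mul_apply, hF, map_zero, LinearMap.add_apply, hE, zero_add,
        LinearMap.smul_apply] at this
      exact (smul_eq_zero.1 this.symm).resolve_left (by exact_mod_cast Nat.succ_ne_zero k)

/-- The semisimple element of an `sl₂`-triple of operators on a finite-dimensional space is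
diagonalizable with integer eigenvalues. On a generalized eigenspace of the Casimir operator only
one highest weight `n` is possible, so vectors killed by `E` have weight exactly `n`, and vectors
killed by `E ^ m` are killed by `∏ (H - (n - 2 i))`, the product over `i < m`. -/
lemma iSup_eigenspace_eq_top (hHE : H * E = E * H + (2 : ℂ) • E)
    (hHF : H * F = F * H - (2 : ℂ) • F) (hEF : E * F = F * E + H) :
    ⨆ i : ℤ, H.eigenspace (i : ℂ) = ⊤ := by
  obtain ⟨N, hN⟩ := isNilpotent_of_shift (c := (-2 : ℂ)) (by norm_num)
    (show H * F = F * H + (-2 : ℂ) • F by rw [hHF, neg_smul, sub_eq_add_neg])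
  obtain ⟨m, hm⟩ := isNilpotent_of_shift (two_ne_zero) hHE
  set Ω : Module.End ℂ V := H * H + (2 : ℂ) • H + (4 : ℂ) • (F * E) with hΩ
  have hΩH : Commute Ω H := by
    have h1 : H * (F * E) = F * E * H := by
      rw [← mul_assoc, hHF, sub_mul, mul_assoc, hHE, mul_add, mul_smul_comm, smul_mul_assoc,
        mul_assoc]
      abel
    simp only [Commute, SemiconjBy, hΩ, add_mul, mul_add, smul_mul_assoc, mul_smul_comm, h1,
      mul_assoc]
  have hΩE : Commute Ω E := by
    have h1 : H * (H * E) = E * (H * H) + (4 : ℂ) • (E * H) + (4 : ℂ) • E := by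
      rw [hHE, mul_add, mul_smul_comm, ← mul_assoc, hHE, add_mul, smul_mul_assoc, mul_assoc]
      module
    have h2 : E * (F * E) = F * (E * E) + E * H + (2 : ℂ) • E := by
      rw [← mul_assoc, hEF, add_mul, hHE, mul_assoc]
      module
    simp only [Commute, SemiconjBy, hΩ, add_mul, mul_add, smul_mul_assoc, mul_smul_comm, mul_assoc]
    rw [h1, h2, hHE]
    module
  rw [eq_top_iff, ← Module.End.iSup_maxGenEigenspace_eq_top Ω]
  refine iSup_le fun c => ?_
  obtain ⟨n, hn⟩ : ∃ n : ℕ, ∀ j : ℕ, (j : ℂ) * (j + 2) = c → j = n := by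
    by_cases hex : ∃ j : ℕ, (j : ℂ) * (j + 2) = c
    · obtain ⟨n, hn⟩ := hex
      refine ⟨n, fun j hj => ?_⟩
      have h1 : j * (j + 2) = n * (n + 2) := by exact_mod_cast hj.trans hn.symm
      nlinarith
    · exact ⟨0, fun j hj => absurd ⟨j, hj⟩ hex⟩
  have hB : ∀ A : Module.End ℂ V, Commute Ω A → ∀ v ∈ Ω.maxGenEigenspace c,
      A v ∈ Ω.maxGenEigenspace c :=
    fun A hA v hv => Module.End.mapsTo_maxGenEigenspace_of_comm hA c hv
  -- An eigenvector of `H` killed by `E` is a Casimir eigenvector.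
  have hzero : ∀ (k : ℕ) (u : V), u ∈ Ω.maxGenEigenspace c → E u = 0 → H u = (k : ℂ) • u →
      k ≠ n → u = 0 := by
    intro k u hu hEu hHu hk
    have hΩu : u ∈ Ω.maxGenEigenspace ((k : ℂ) * (k + 2)) := by
      refine (Module.End.genEigenspace _ _).mono le_top (Module.End.mem_eigenspace_iff.2 ?_)
      simp only [hΩ, LinearMap.add_apply, Module.End.mul_apply, LinearMap.smul_apply, hEu, hHu,
        map_zero, map_smul]
      module
    exact Submodule.disjoint_def.1 (Module.End.disjoint_genEigenspace Ω
      (fun h => hk (hn k h)) ⊤ ⊤) u hΩu hu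
  have hhw : ∀ (k : ℕ) (v : V), v ∈ Ω.maxGenEigenspace c → E v = 0 →
      aeval H (∏ j ∈ Finset.range k, (X - C (j : ℂ))) v = 0 →
      H v = (n : ℂ) • v ∧ (k ≤ n → v = 0) := by
    intro k
    induction k with
    | zero =>
      intro v _ _ h
      have : v = 0 := by simpa using h
      simp [this]
    | succ k ih =>
      intro v hv hEv h
      have hEH : E (H v) = 0 := by
        have := LinearMap.congr_fun hHE v
        simpa [hEv] using this.symm
      rw [Finset.prod_range_succ, map_mul, Module.End.mul_apply, aeval_X_sub_C_apply] at h
      obtain ⟨h1, h2⟩ := ih _ (sub_mem (hB H hΩH v hv) (Submodule.smul_mem _ _ hv))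
        (by simp [hEH, hEv]) h
      rcases lt_trichotomy n k with hlt | rfl | hlt
      · refine ⟨?_, fun hle => absurd hle (by omega)⟩
        refine sub_eq_zero.1 (hzero k _ (sub_mem (hB H hΩH v hv) (Submodule.smul_mem _ (n : ℂ) hv))
          (by simp [hEH, hEv]) ?_ hlt.ne')
        simp only [map_sub, map_smul, smul_sub] at h1 ⊢
        rw [sub_eq_iff_eq_add] at h1
        rw [h1]
        module
      · exact ⟨sub_eq_zero.1 (h2 le_rfl), fun hle => absurd hle (by omega)⟩
      · have h0 : v = 0 := hzero k v hv hEv (sub_eq_zero.1 (h2 hlt.le)) hlt.ne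
        simp [h0]
  have hinter : ∀ (a : ℂ) (r : ℕ),
      aeval H (∏ i ∈ Finset.range r, (X - C (a - 2 * i))) * E =
        E * aeval H (∏ i ∈ Finset.range r, (X - C (a - 2 * (i + 1 : ℕ)))) := by
    intro a r
    induction r with
    | zero => simp
    | succ r ih =>
      rw [Finset.prod_range_succ, Finset.prod_range_succ, map_mul, map_mul, ← mul_assoc, ← ih,
        mul_assoc, mul_assoc]
      congr 1
      simp only [map_sub, aeval_X, aeval_C, sub_mul, mul_sub, hHE, Algebra.algebraMap_eq_smul_one,
        smul_mul_assoc, mul_smul_comm, one_mul, mul_one, Nat.cast_add, Nat.cast_one]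
      module
  have hkill : ∀ (r : ℕ) (v : V), v ∈ Ω.maxGenEigenspace c → (E ^ r) v = 0 →
      (aeval H (∏ i ∈ Finset.range r, (X - C ((n : ℂ) - 2 * i)))) v = 0 := by
    intro r
    induction r with
    | zero => intro v _ h; simpa using h
    | succ r ih =>
      intro v hv h
      rw [pow_succ, Module.End.mul_apply] at h
      have h1 := ih (E v) (hB E hΩE v hv) h
      rw [← Module.End.mul_apply, hinter, Module.End.mul_apply] at h1
      set u := (aeval H (∏ i ∈ Finset.range r, (X - C ((n : ℂ) - 2 * (i + 1 : ℕ))))) v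
      have hu : u ∈ Ω.maxGenEigenspace c := by
        refine hB _ ?_ v hv
        rw [aeval_eq_sum_range]
        exact Commute.sum_right _ _ _ fun i _ => (hΩH.pow_right i).smul_right _
      obtain ⟨h2, -⟩ := hhw N u hu h1
        (prod_apply_of_f_pow hHE hHF hEF N u h1 (by simp [hN]))
      rw [Finset.prod_range_succ', mul_comm, map_mul, Module.End.mul_apply]
      change (aeval H (X - C ((n : ℂ) - 2 * ((0 : ℕ) : ℂ)))) u = 0
      rw [aeval_X_sub_C_apply, h2, Nat.cast_zero, mul_zero, sub_zero, sub_self]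
  intro v hv
  refine mem_iSup_eigenspace_of_prod H (a := fun i => (n : ℤ) - 2 * i)
    (fun i j hij => by simpa using hij) m v ?_
  have := hkill m v hv (by simp [hm])
  push_cast
  exact this

variable {𝔤 : Type*} [LieRing 𝔤] [LieAlgebra ℂ 𝔤] [FiniteDimensional ℂ 𝔤] {e h f : 𝔤}

omit [FiniteDimensional ℂ 𝔤] in
lemma mem_weightSpace {h x : 𝔤} {i : ℤ} : x ∈ weightSpace h i ↔ ⁅h, x⁆ = (i : ℂ) • x :=
  Module.End.mem_eigenspace_iff

/-- The Lie algebra is the sum of its weight spaces. -/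
lemma iSup_weightSpace (ht : IsSl2Triple h e f) : ⨆ i : ℤ, weightSpace h i = ⊤ := by
  refine iSup_eigenspace_eq_top (E := LieAlgebra.ad ℂ 𝔤 e) (F := LieAlgebra.ad ℂ 𝔤 f) ?_ ?_ ?_ <;>
    ext x <;> simp only [Module.End.mul_apply, LieAlgebra.ad_apply, LinearMap.add_apply,
      LinearMap.sub_apply, LinearMap.smul_apply]
  · rw [leibniz_lie, ht.lie_h_e_smul ℂ, smul_lie, add_comm]
  · rw [leibniz_lie, ht.lie_lie_smul_f ℂ, neg_lie, smul_lie]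
    abel
  · rw [leibniz_lie, ht.lie_e_f, add_comm]

/-- `ad e` is injective on the weight spaces of negative weight. -/
lemma eq_zero_of_lie_e (ht : IsSl2Triple h e f) {i : ℤ} (hi : i < 0) {x : 𝔤}
    (hx : x ∈ weightSpace h i) (hex : ⁅e, x⁆ = 0) : x = 0 := by
  by_contra hne
  obtain ⟨n, hn⟩ := (IsSl2Triple.HasPrimitiveVectorWith.mk (t := ht) hne
    (mem_weightSpace.1 hx) hex).exists_nat
  have : i = n := by exact_mod_cast hn
  omega

end SlTwo

/-! ### The weight filtration, the subspace `𝔪` and its orthogonal complement -/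

section Weights

variable {𝔤 : Type*} [LieRing 𝔤] [LieAlgebra ℂ 𝔤]

/-- The sum of the weight spaces of weight at most `i`. -/
def weightFil (h : 𝔤) (i : ℤ) : Submodule ℂ 𝔤 :=
  ⨆ (j : ℤ) (_ : j ≤ i), weightSpace h j

lemma weightSpace_le_weightFil (h : 𝔤) {i j : ℤ} (hij : i ≤ j) : weightSpace h i ≤ weightFil h j :=
  le_iSup₂_of_le i hij le_rfl

lemma weightFil_le {h : 𝔤} {i : ℤ} {p : Submodule ℂ 𝔤} (hp : ∀ j ≤ i, weightSpace h j ≤ p) :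
    weightFil h i ≤ p :=
  iSup₂_le hp

lemma weightFil_mono (h : 𝔤) {i j : ℤ} (hij : i ≤ j) : weightFil h i ≤ weightFil h j :=
  weightFil_le fun _ hk => weightSpace_le_weightFil h (hk.trans hij)

lemma lie_mem_weightSpace {h x y : 𝔤} {i j : ℤ} (hx : x ∈ weightSpace h i)
    (hy : y ∈ weightSpace h j) : ⁅x, y⁆ ∈ weightSpace h (i + j) := by
  rw [mem_weightSpace] at *
  rw [leibniz_lie, hx, hy, smul_lie, lie_smul, Int.cast_add, add_smul]

lemma lie_mem_weightFil {h x y : 𝔤} {i j k : ℤ} (hx : x ∈ weightFil h i) (hy : y ∈ weightFil h j)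
    (hk : i + j ≤ k) : ⁅x, y⁆ ∈ weightFil h k := by
  have h1 : ∀ a ≤ i, ∀ x ∈ weightSpace h a, ∀ b ≤ j, ∀ y ∈ weightSpace h b,
      ⁅x, y⁆ ∈ weightFil h k := fun a ha x hx b hb y hy =>
    weightSpace_le_weightFil h (by omega) (lie_mem_weightSpace hx hy)
  have h2 : ∀ a ≤ i, ∀ x ∈ weightSpace h a, ⁅x, y⁆ ∈ weightFil h k := by
    intro a ha x hx
    exact (weightFil_le (p := (weightFil h k).comap (LieAlgebra.ad ℂ 𝔤 x))
      fun b hb y hy => h1 a ha x hx b hb y hy) hy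
  have h3 := (weightFil_le (p := (weightFil h k).comap (LieAlgebra.ad ℂ 𝔤 y))
    fun a ha x hx => by
      change ⁅y, x⁆ ∈ weightFil h k
      rw [← lie_skew]
      exact neg_mem (h2 a ha x hx)) hx
  rw [← lie_skew]
  exact neg_mem h3

variable {κ : LinearMap.BilinForm ℂ 𝔤}

lemma lieInvariant_left (hκ_inv : κ.lieInvariant 𝔤) (x y z : 𝔤) : κ ⁅x, y⁆ z = κ x ⁅y, z⁆ := by
  rw [← lie_skew, map_neg, LinearMap.neg_apply, hκ_inv, neg_neg]

/-- Weight spaces are orthogonal unless their weights are opposite. -/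
lemma form_eq_zero_of_weight (hκ_inv : κ.lieInvariant 𝔤) {h x y : 𝔤} {i j : ℤ} (hij : i + j ≠ 0)
    (hx : x ∈ weightSpace h i) (hy : y ∈ weightSpace h j) : κ x y = 0 := by
  rw [mem_weightSpace] at hx hy
  have h1 := hκ_inv h x y
  rw [hx, hy, map_smul, map_smul, LinearMap.smul_apply, smul_eq_mul, smul_eq_mul] at h1
  have h2 : ((i + j : ℤ) : ℂ) * κ x y = 0 := by
    push_cast
    linear_combination h1
  exact (mul_eq_zero.1 h2).resolve_left (by exact_mod_cast hij)

lemma form_eq_zero_of_weightFil (hκ_inv : κ.lieInvariant 𝔤) {h x y : 𝔤} {i j : ℤ} (hij : i + j < 0)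
    (hx : x ∈ weightFil h i) (hy : y ∈ weightFil h j) : κ x y = 0 := by
  have h2 : ∀ a ≤ i, ∀ x ∈ weightSpace h a, κ x y = 0 := by
    intro a ha x hx
    exact (weightFil_le (p := LinearMap.ker (κ x))
      fun b hb y hy => form_eq_zero_of_weight hκ_inv (by omega) hx hy) hy
  exact (weightFil_le (p := LinearMap.ker (LinearMap.flip κ y)) fun a ha x hx => h2 a ha x hx) hx

variable [FiniteDimensional ℂ 𝔤] {e h f : 𝔤}

omit [FiniteDimensional ℂ 𝔤] in
lemma weightSpace_le_maxGenEigenspace (h : 𝔤) (i : ℤ) :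
    weightSpace h i ≤ (LieAlgebra.ad ℂ 𝔤 h).maxGenEigenspace (i : ℂ) :=
  (Module.End.genEigenspace _ _).mono le_top

lemma weightProj_of_mem {i : ℤ} {x : 𝔤} (hx : x ∈ weightSpace h i) : weightProj h i x = x :=
  Submodule.projection_apply_of_mem_left _ (weightSpace_le_maxGenEigenspace h i hx)

lemma weightProj_eq_zero {i j : ℤ} (hij : i ≠ j) {x : 𝔤} (hx : x ∈ weightSpace h i) :
    weightProj h j x = 0 :=
  weightProj_of_mem_ne h j (by exact_mod_cast hij) (weightSpace_le_maxGenEigenspace h i hx)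

/-- A linear statement holds on the whole Lie algebra if it holds on weight vectors. -/
lemma le_of_weightSpace_le (ht : IsSl2Triple h e f) {p : Submodule ℂ 𝔤}
    (hp : ∀ i, weightSpace h i ≤ p) (x : 𝔤) : x ∈ p := by
  have h1 : (⊤ : Submodule ℂ 𝔤) ≤ p := by
    rw [← iSup_weightSpace ht]
    exact iSup_le hp
  exact h1 trivial

lemma weightProj_mem (ht : IsSl2Triple h e f) (i : ℤ) (x : 𝔤) :
    weightProj h i x ∈ weightSpace h i := by
  refine le_of_weightSpace_le ht (p := (weightSpace h i).comap (weightProj h i)) (fun j y hy => ?_) x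
  rw [Submodule.mem_comap]
  by_cases hij : j = i
  · subst hij
    rwa [weightProj_of_mem hy]
  · rw [weightProj_eq_zero hij hy]
    exact zero_mem _

lemma weightProj_lie (ht : IsSl2Triple h e f) {a : ℤ} {y : 𝔤} (hy : y ∈ weightSpace h a) (i : ℤ)
    (x : 𝔤) : weightProj h (a + i) ⁅y, x⁆ = ⁅y, weightProj h i x⁆ := by
  refine le_of_weightSpace_le ht (p := LinearMap.eqLocus
    (weightProj h (a + i) ∘ₗ LieAlgebra.ad ℂ 𝔤 y) (LieAlgebra.ad ℂ 𝔤 y ∘ₗ weightProj h i))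
    (fun j x hx => ?_) x
  change weightProj h (a + i) ⁅y, x⁆ = ⁅y, weightProj h i x⁆
  by_cases hij : j = i
  · subst hij
    rw [weightProj_of_mem hx, weightProj_of_mem (lie_mem_weightSpace hy hx)]
  · rw [weightProj_eq_zero hij hx, lie_zero,
      weightProj_eq_zero (fun h' => hij (by omega)) (lie_mem_weightSpace hy hx)]

/-- An `ad h`-stable subspace is spanned by weight vectors. -/
lemma le_iSup_inf_weightSpace (ht : IsSl2Triple h e f) {C : Submodule ℂ 𝔤}
    (hC : ∀ x ∈ C, ⁅h, x⁆ ∈ C) : C ≤ ⨆ i : ℤ, C ⊓ weightSpace h i := by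
  have htop : ⨆ c : ℂ, (LieAlgebra.ad ℂ 𝔤 h).genEigenspace c 1 = ⊤ := by
    rw [eq_top_iff, ← iSup_weightSpace ht]
    exact iSup_le fun i => le_iSup_of_le (i : ℂ) le_rfl
  have key := Submodule.eq_iSup_inf_genEigenspace (p := C) (f := LieAlgebra.ad ℂ 𝔤 h) 1
    (fun x hx => by simpa using hC x hx) htop
  conv_lhs => rw [key]
  refine iSup_le fun c x hx => ?_
  by_cases hc : ∃ i : ℤ, c = i
  · obtain ⟨i, rfl⟩ := hc
    exact Submodule.mem_iSup_of_mem i hx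
  · have h0 : x = 0 := by
      have hx' : x ∈ (LieAlgebra.ad ℂ 𝔤 h).genEigenspace c 1 := hx.2
      have hsum : x ∈ ⨆ (d : ℂ) (_ : d ≠ c), (LieAlgebra.ad ℂ 𝔤 h).maxGenEigenspace d := by
        refine le_of_weightSpace_le ht (fun i => ?_) x
        exact (weightSpace_le_maxGenEigenspace h i).trans
          (le_iSup₂_of_le (i : ℂ) (fun h' => hc ⟨i, h'.symm⟩) le_rfl)
      exact Submodule.disjoint_def.1 ((LieAlgebra.ad ℂ 𝔤 h).independent_maxGenEigenspace c) x
        ((Module.End.genEigenspace _ _).mono le_top hx') hsum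
    rw [h0]
    exact zero_mem _

lemma weightProj_mem_of_stable (ht : IsSl2Triple h e f) {C : Submodule ℂ 𝔤}
    (hC : ∀ x ∈ C, ⁅h, x⁆ ∈ C) (i : ℤ) {x : 𝔤} (hx : x ∈ C) : weightProj h i x ∈ C := by
  suffices C ≤ C.comap (weightProj h i) from this hx
  refine (le_iSup_inf_weightSpace ht hC).trans (iSup_le fun j y hy => ?_)
  rw [Submodule.mem_comap]
  by_cases hij : j = i
  · subst hij
    rw [weightProj_of_mem hy.2]
    exact hy.1
  · rw [weightProj_eq_zero hij hy.2]
    exact zero_mem _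

lemma weightProj_eq_zero_of_weightFil {i j : ℤ} (hij : i < j) {x : 𝔤} (hx : x ∈ weightFil h i) :
    weightProj h j x = 0 :=
  (weightFil_le (p := LinearMap.ker (weightProj h j))
    fun _ hk _ hy => weightProj_eq_zero (by omega) hy) hx

lemma mem_weightFil_sub_one {i : ℤ} {x : 𝔤} (hx : x ∈ weightFil h i) (h0 : weightProj h i x = 0) :
    x ∈ weightFil h (i - 1) := by
  have h1 : weightFil h i ≤ weightSpace h i ⊔ weightFil h (i - 1) := by
    refine weightFil_le fun j hj => ?_
    rcases hj.eq_or_lt with rfl | hlt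
    · exact le_sup_left
    · exact (weightSpace_le_weightFil h (by omega)).trans le_sup_right
  obtain ⟨a, ha, b, hb, rfl⟩ := Submodule.mem_sup.1 (h1 hx)
  rw [map_add, weightProj_of_mem ha, weightProj_eq_zero_of_weightFil (by omega) hb,
    add_zero] at h0
  rwa [h0, zero_add]

/-- Only finitely many weights occur. -/
lemma exists_weight_bound (ht : IsSl2Triple h e f) :
    ∃ N : ℕ, weightFil h N = ⊤ ∧ weightFil h (-N) = ⊥ := by
  have hfin := finite_support_weightProj h
  obtain ⟨N, hN⟩ : ∃ N : ℕ, ∀ i : ℤ, weightSpace h i ≠ ⊥ → i.natAbs < N := by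
    obtain ⟨b, hb⟩ := (hfin.image Int.natAbs).bddAbove
    refine ⟨b + 1, fun i hi => Nat.lt_succ_of_le (hb ⟨i, fun h0 => hi ?_, rfl⟩)⟩
    refine (Submodule.eq_bot_iff _).2 fun x hx => ?_
    rw [← weightProj_of_mem hx, h0, LinearMap.zero_apply]
  refine ⟨N, ?_, ?_⟩
  · refine eq_top_iff.2 fun x _ => le_of_weightSpace_le ht (fun i => ?_) x
    by_cases hi : weightSpace h i = ⊥
    · rw [hi]; exact bot_le
    · exact weightSpace_le_weightFil h (by have := hN i hi; omega)
  · refine eq_bot_iff.2 (weightFil_le fun i hi => ?_)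
    by_contra hne
    have := hN i fun h0 => hne (h0 ▸ le_rfl)
    omega

omit [FiniteDimensional ℂ 𝔤] in
lemma e_mem_weightSpace (ht : IsSl2Triple h e f) : e ∈ weightSpace h 2 := by
  rw [mem_weightSpace, ht.lie_h_e_smul ℂ]
  norm_num

omit [FiniteDimensional ℂ 𝔤] in
lemma e_mem_weightFil (ht : IsSl2Triple h e f) : e ∈ weightFil h 2 :=
  weightSpace_le_weightFil h le_rfl (e_mem_weightSpace ht)

omit [FiniteDimensional ℂ 𝔤] in
lemma form_comm (hκ_symm : κ.IsSymm) (x y : 𝔤) : κ x y = κ y x :=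
  hκ_symm.eq x y

/-- The image of `ad e` is the orthogonal complement of its kernel. -/
lemma mem_range_ad_of_orthogonal_ker (hκ : κ.Nondegenerate) (hκ_symm : κ.IsSymm)
    (hκ_inv : κ.lieInvariant 𝔤) (e : 𝔤) {w : 𝔤} (hw : ∀ u, ⁅e, u⁆ = 0 → κ w u = 0) :
    w ∈ LinearMap.range (LieAlgebra.ad ℂ 𝔤 e) := by
  rw [← LinearMap.BilinForm.orthogonal_orthogonal hκ hκ_symm.isRefl
    (LinearMap.range (LieAlgebra.ad ℂ 𝔤 e)), LinearMap.BilinForm.mem_orthogonal_iff]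
  intro u hu
  rw [form_comm hκ_symm]
  refine hw u ?_
  refine LinearMap.ker_eq_bot'.1 hκ.ker_eq_bot _ (LinearMap.ext fun v => ?_)
  have h1 := LinearMap.BilinForm.mem_orthogonal_iff.1 hu _ ⟨v, rfl⟩
  rw [LieAlgebra.ad_apply, form_comm hκ_symm, ← lieInvariant_left hκ_inv, ← lie_skew,
    map_neg, LinearMap.neg_apply, neg_eq_zero] at h1
  exact h1

/-- Vectors of positive weight lie in the image of `ad e`. -/
lemma weightSpace_le_range_ad (hκ : κ.Nondegenerate) (hκ_symm : κ.IsSymm)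
    (hκ_inv : κ.lieInvariant 𝔤) (ht : IsSl2Triple h e f) {i : ℤ} (hi : 1 ≤ i) :
    weightSpace h i ≤ LinearMap.range (LieAlgebra.ad ℂ 𝔤 e) := by
  intro w hw
  refine mem_range_ad_of_orthogonal_ker hκ hκ_symm hκ_inv e fun u hu => ?_
  have hst : ∀ x ∈ LinearMap.ker (LieAlgebra.ad ℂ 𝔤 e), ⁅h, x⁆ ∈
      LinearMap.ker (LieAlgebra.ad ℂ 𝔤 e) := by
    intro x hx
    have hx' : ⁅e, x⁆ = 0 := hx
    change ⁅e, ⁅h, x⁆⁆ = 0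
    rw [leibniz_lie, hx', lie_zero, add_zero, ← lie_skew e h, ht.lie_h_e_smul ℂ, neg_lie, smul_lie,
      hx', smul_zero, neg_zero]
  have hle : LinearMap.ker (LieAlgebra.ad ℂ 𝔤 e) ≤ LinearMap.ker (κ w) := by
    refine (le_iSup_inf_weightSpace ht hst).trans (iSup_le fun j x hx => ?_)
    by_cases hj : j < 0
    · rw [eq_zero_of_lie_e ht hj hx.2 hx.1]
      exact zero_mem _
    · exact form_eq_zero_of_weight hκ_inv (by omega) hw hx.2
  exact hle hu

/-- The linear part of an MV slice has weights at most `0`. -/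
lemma complement_le_weightFil (hκ : κ.Nondegenerate) (hκ_symm : κ.IsSymm)
    (hκ_inv : κ.lieInvariant 𝔤) (ht : IsSl2Triple h e f) {C : Submodule ℂ 𝔤}
    (hC : ∀ x ∈ C, ⁅h, x⁆ ∈ C) (hcompl : IsCompl (LinearMap.range (LieAlgebra.ad ℂ 𝔤 e)) C) :
    C ≤ weightFil h 0 := by
  refine (le_iSup_inf_weightSpace ht hC).trans (iSup_le fun i x hx => ?_)
  by_cases hi : i ≤ 0
  · exact weightSpace_le_weightFil h hi hx.2
  · rw [Submodule.disjoint_def.1 hcompl.disjoint x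
      (weightSpace_le_range_ad hκ hκ_symm hκ_inv ht (by omega) hx.2) hx.1]
    exact zero_mem _

/-- The leading term of `[y, e]` for `y` of negative weights is not cancelled by `C`. -/
lemma mem_weightFil_of_lie_e_mem (ht : IsSl2Triple h e f) {C : Submodule ℂ 𝔤}
    (hC : ∀ x ∈ C, ⁅h, x⁆ ∈ C) (hcompl : IsCompl (LinearMap.range (LieAlgebra.ad ℂ 𝔤 e)) C)
    {j : ℤ} (hj : j < 0) {y : 𝔤} (hy : y ∈ weightFil h j)
    (hye : ⁅y, e⁆ ∈ C ⊔ weightFil h (j + 1)) : y ∈ weightFil h (j - 1) := by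
  refine mem_weightFil_sub_one hy (eq_zero_of_lie_e ht hj (weightProj_mem ht j y) ?_)
  obtain ⟨c, hc, w, hw, hcw⟩ := Submodule.mem_sup.1 hye
  refine Submodule.disjoint_def.1 hcompl.disjoint _ ⟨_, rfl⟩ ?_
  rw [← weightProj_lie ht (e_mem_weightSpace ht), ← lie_skew, ← hcw, map_neg,
    map_add, weightProj_eq_zero_of_weightFil (by omega) hw, add_zero]
  exact neg_mem (weightProj_mem_of_stable ht hC _ hc)

end Weights

section Reduction

variable {𝔤 : Type*} [LieRing 𝔤] [LieAlgebra ℂ 𝔤] {κ : LinearMap.BilinForm ℂ 𝔤} {e h f : 𝔤}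
  {𝔩 : Submodule ℂ 𝔤}

lemma nilp_le_weightFil (h𝔩 : IsLagrangian κ e h 𝔩) : nilp h 𝔩 ≤ weightFil h (-1) :=
  sup_le (h𝔩.1.trans (weightSpace_le_weightFil h le_rfl)) (weightFil_mono h (by norm_num))

lemma weightFil_le_nilp (h : 𝔤) (𝔩 : Submodule ℂ 𝔤) : weightFil h (-2) ≤ nilp h 𝔩 := le_sup_right

lemma lie_mem_nilp (h𝔩 : IsLagrangian κ e h 𝔩) {x y : 𝔤} (hx : x ∈ nilp h 𝔩) (hy : y ∈ nilp h 𝔩) :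
    ⁅x, y⁆ ∈ nilp h 𝔩 :=
  weightFil_le_nilp h 𝔩
    (lie_mem_weightFil (nilp_le_weightFil h𝔩 hx) (nilp_le_weightFil h𝔩 hy) (by norm_num))

/-- The functional `κ(e, ·)` is a character of `𝔪`. -/
lemma form_e_lie_nilp (hκ_inv : κ.lieInvariant 𝔤) (ht : IsSl2Triple h e f)
    (h𝔩 : IsLagrangian κ e h 𝔩) {x y : 𝔤} (hx : x ∈ nilp h 𝔩) (hy : y ∈ nilp h 𝔩) :
    κ e ⁅x, y⁆ = 0 := by
  have he : e ∈ weightFil h 2 :=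
    weightSpace_le_weightFil h le_rfl (by rw [mem_weightSpace, ht.lie_h_e_smul ℂ]; norm_num)
  have h3 : ∀ z ∈ weightFil h (-3), κ e z = 0 := fun z hz =>
    form_eq_zero_of_weightFil hκ_inv (by norm_num) he hz
  have hy' := nilp_le_weightFil h𝔩 hy
  obtain ⟨a, ha, b, hb, rfl⟩ := Submodule.mem_sup.1 hx
  rw [add_lie, map_add, h3 _ (lie_mem_weightFil hb hy' (by norm_num)), add_zero]
  obtain ⟨a', ha', b', hb', rfl⟩ := Submodule.mem_sup.1 hy
  have ha1 := weightSpace_le_weightFil h le_rfl (h𝔩.1 ha)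
  rw [lie_add, map_add, h3 _ (lie_mem_weightFil ha1 hb' (by norm_num)), add_zero]
  exact (h𝔩.2 a (h𝔩.1 ha)).1 ha a' ha'

lemma lie_h_mem_nilp (h𝔩 : IsLagrangian κ e h 𝔩) {x : 𝔤} (hx : x ∈ nilp h 𝔩) :
    ⁅h, x⁆ ∈ nilp h 𝔩 := by
  obtain ⟨a, ha, b, hb, rfl⟩ := Submodule.mem_sup.1 hx
  rw [lie_add]
  refine add_mem ?_ ?_
  · rw [mem_weightSpace.1 (h𝔩.1 ha)]
    exact Submodule.smul_mem _ _ (le_sup_left (a := 𝔩) ha)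
  · have hh : h ∈ weightFil h 0 :=
      weightSpace_le_weightFil h le_rfl (by rw [mem_weightSpace]; simp)
    exact weightFil_le_nilp h 𝔩 (lie_mem_weightFil hh hb (by norm_num))

lemma mem_orthogonal_iff_form (hκ_symm : κ.IsSymm) {𝔪 : Submodule ℂ 𝔤} {x : 𝔤} :
    x ∈ κ.orthogonal 𝔪 ↔ ∀ y ∈ 𝔪, κ x y = 0 := by
  rw [LinearMap.BilinForm.mem_orthogonal_iff]
  exact forall₂_congr fun y _ => by rw [form_comm hκ_symm]

lemma mem_momentFiber_iff (hκ_symm : κ.IsSymm) {𝔪 : Submodule ℂ 𝔤} {x : 𝔤} :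
    x ∈ momentFiber κ e 𝔪 ↔ x - e ∈ κ.orthogonal 𝔪 := by
  simp [mem_orthogonal_iff_form hκ_symm, momentFiber, sub_eq_zero]

lemma add_mem_momentFiber (hκ_symm : κ.IsSymm) {𝔪 : Submodule ℂ 𝔤} {x z : 𝔤}
    (hx : x ∈ momentFiber κ e 𝔪) (hz : z ∈ κ.orthogonal 𝔪) : x + z ∈ momentFiber κ e 𝔪 := by
  rw [mem_momentFiber_iff hκ_symm] at *
  rw [add_sub_right_comm]
  exact add_mem hx hz

lemma lie_mem_orthogonal (hκ_symm : κ.IsSymm) (hκ_inv : κ.lieInvariant 𝔤)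
    (h𝔩 : IsLagrangian κ e h 𝔩) {y z : 𝔤} (hy : y ∈ nilp h 𝔩) (hz : z ∈ κ.orthogonal (nilp h 𝔩)) :
    ⁅y, z⁆ ∈ κ.orthogonal (nilp h 𝔩) := by
  rw [mem_orthogonal_iff_form hκ_symm] at *
  intro m hm
  rw [hκ_inv, hz _ (lie_mem_nilp h𝔩 hy hm), neg_zero]

/-- The vector fields `x ↦ [y, x]`, `y ∈ 𝔪`, are tangent to the fibre. -/
lemma lie_mem_orthogonal_of_momentFiber (hκ_symm : κ.IsSymm) (hκ_inv : κ.lieInvariant 𝔤)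
    (ht : IsSl2Triple h e f) (h𝔩 : IsLagrangian κ e h 𝔩) {y x : 𝔤} (hy : y ∈ nilp h 𝔩)
    (hx : x ∈ momentFiber κ e (nilp h 𝔩)) : ⁅y, x⁆ ∈ κ.orthogonal (nilp h 𝔩) := by
  rw [mem_orthogonal_iff_form hκ_symm]
  intro m hm
  rw [hκ_inv, hx _ (lie_mem_nilp h𝔩 hy hm), form_e_lie_nilp hκ_inv ht h𝔩 hy hm, neg_zero]

variable [FiniteDimensional ℂ 𝔤] {C : Submodule ℂ 𝔤}

lemma complement_le_orthogonal (hκ : κ.Nondegenerate) (hκ_symm : κ.IsSymm)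
    (hκ_inv : κ.lieInvariant 𝔤) (ht : IsSl2Triple h e f) (h𝔩 : IsLagrangian κ e h 𝔩)
    (hC : ∀ x ∈ C, ⁅h, x⁆ ∈ C) (hcompl : IsCompl (LinearMap.range (LieAlgebra.ad ℂ 𝔤 e)) C) :
    C ≤ κ.orthogonal (nilp h 𝔩) := by
  intro c hc
  rw [mem_orthogonal_iff_form hκ_symm]
  intro y hy
  exact form_eq_zero_of_weightFil hκ_inv (by norm_num)
    (complement_le_weightFil hκ hκ_symm hκ_inv ht hC hcompl hc) (nilp_le_weightFil h𝔩 hy)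

/-- Every weight vector of `𝔪^⊥` lies in `[𝔪, e] + C`, with the `𝔪`-part of the expected weight. -/
lemma exists_decomp_of_weight (hκ : κ.Nondegenerate) (hκ_symm : κ.IsSymm)
    (hκ_inv : κ.lieInvariant 𝔤) (ht : IsSl2Triple h e f) (h𝔩 : IsLagrangian κ e h 𝔩)
    (hC : ∀ x ∈ C, ⁅h, x⁆ ∈ C) (hcompl : IsCompl (LinearMap.range (LieAlgebra.ad ℂ 𝔤 e)) C)
    {i : ℤ} {z : 𝔤} (hz : z ∈ κ.orthogonal (nilp h 𝔩)) (hzi : z ∈ weightSpace h i) :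
    ∃ y ∈ nilp h 𝔩 ⊓ weightFil h (i - 2), ∃ c ∈ C, z = ⁅y, e⁆ + c := by
  rw [mem_orthogonal_iff_form hκ_symm] at hz
  have he := e_mem_weightSpace ht
  -- Taking components of weight `i` in a decomposition of `z` along `[𝔤, e] ⊕ C`.
  have hcomp : ∃ y ∈ weightSpace h (i - 2), ∃ c ∈ C, z = ⁅y, e⁆ + c := by
    obtain ⟨_, ⟨y, rfl⟩, c, hc, hyc⟩ := Submodule.mem_sup.1
      (hcompl.sup_eq_top ▸ Submodule.mem_top : z ∈ LinearMap.range (LieAlgebra.ad ℂ 𝔤 e) ⊔ C)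
    refine ⟨-weightProj h (i - 2) y, neg_mem (weightProj_mem ht _ y), weightProj h i c,
      weightProj_mem_of_stable ht hC i hc, ?_⟩
    have h1 := weightProj_lie ht he (i - 2) y
    rw [add_sub_cancel] at h1
    rw [neg_lie, lie_skew, ← h1, ← map_add]
    change z = weightProj h i (LieAlgebra.ad ℂ 𝔤 e y + c)
    rw [hyc, weightProj_of_mem hzi]
  obtain ⟨y, hy, c, hc, hyc⟩ := hcomp
  rcases lt_trichotomy i 1 with hi | rfl | hi
  · exact ⟨y, ⟨weightFil_le_nilp h 𝔩 (weightSpace_le_weightFil h (by omega) hy),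
      weightSpace_le_weightFil h le_rfl hy⟩, c, hc, hyc⟩
  · refine ⟨y, ⟨le_sup_left (a := 𝔩) ((h𝔩.2 y hy).2 fun y' hy' => ?_),
      weightSpace_le_weightFil h le_rfl hy⟩, c, hc, hyc⟩
    have hm : y' ∈ nilp h 𝔩 := le_sup_left (a := 𝔩) hy'
    have h1 := hz y' hm
    have h2 := (mem_orthogonal_iff_form hκ_symm).1
      (complement_le_orthogonal hκ hκ_symm hκ_inv ht h𝔩 hC hcompl hc) y' hm
    rw [hyc, map_add, LinearMap.add_apply, h2, add_zero, ← lie_skew, map_neg, LinearMap.neg_apply,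
      neg_eq_zero, lieInvariant_left hκ_inv] at h1
    exact h1
  · have h0 : z = 0 := by
      refine LinearMap.ker_eq_bot'.1 hκ.ker_eq_bot _ (LinearMap.ext fun v => ?_)
      refine le_of_weightSpace_le ht (p := LinearMap.ker (κ z)) (fun j v hv => ?_) v
      by_cases hij : i + j = 0
      · exact hz v (weightFil_le_nilp h 𝔩 (weightSpace_le_weightFil h (by omega) hv))
      · exact form_eq_zero_of_weight hκ_inv hij hzi hv
    exact ⟨0, zero_mem _, 0, zero_mem _, by simp [h0]⟩

/-- `𝔪^⊥ = [𝔪, e] + C`, compatibly with the filtration by weights. -/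
lemma exists_decomp (hκ : κ.Nondegenerate) (hκ_symm : κ.IsSymm)
    (hκ_inv : κ.lieInvariant 𝔤) (ht : IsSl2Triple h e f) (h𝔩 : IsLagrangian κ e h 𝔩)
    (hC : ∀ x ∈ C, ⁅h, x⁆ ∈ C) (hcompl : IsCompl (LinearMap.range (LieAlgebra.ad ℂ 𝔤 e)) C)
    {i : ℤ} {z : 𝔤} (hz : z ∈ κ.orthogonal (nilp h 𝔩)) (hzi : z ∈ weightFil h i) :
    ∃ y ∈ nilp h 𝔩 ⊓ weightFil h (i - 2), ∃ c ∈ C, z = ⁅y, e⁆ + c := by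
  set p : Submodule ℂ 𝔤 := (nilp h 𝔩 ⊓ weightFil h (i - 2)).map (LieAlgebra.ad ℂ 𝔤 e) ⊔ C with hp
  have hst : ∀ x ∈ κ.orthogonal (nilp h 𝔩) ⊓ weightFil h i,
      ⁅h, x⁆ ∈ κ.orthogonal (nilp h 𝔩) ⊓ weightFil h i := by
    rintro x ⟨hx, hxi⟩
    refine ⟨(mem_orthogonal_iff_form hκ_symm).2 ?_, lie_mem_weightFil
      (weightSpace_le_weightFil h le_rfl
        (show h ∈ weightSpace h 0 by rw [mem_weightSpace]; simp)) hxi (by omega)⟩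
    replace hx := (mem_orthogonal_iff_form hκ_symm).1 hx
    intro m hm
    rw [hκ_inv, hx _ (lie_h_mem_nilp h𝔩 hm), neg_zero]
  have hle : κ.orthogonal (nilp h 𝔩) ⊓ weightFil h i ≤ p := by
    refine (le_iSup_inf_weightSpace ht hst).trans (iSup_le fun j x hx => ?_)
    rcases le_or_gt j i with hj | hj
    · obtain ⟨y, hy, c, hc, rfl⟩ := exists_decomp_of_weight hκ hκ_symm hκ_inv ht h𝔩 hC hcompl
        hx.1.1 hx.2
      refine Submodule.add_mem_sup ⟨-y, neg_mem ⟨hy.1, weightFil_mono h (by omega) hy.2⟩, ?_⟩ hc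
      simp
    · rw [← weightProj_of_mem hx.2, weightProj_eq_zero_of_weightFil hj hx.1.2]
      exact zero_mem _
  obtain ⟨_, ⟨y, hy, rfl⟩, c, hc, hyc⟩ := Submodule.mem_sup.1 (hle ⟨hz, hzi⟩)
  exact ⟨-y, neg_mem hy, c, hc, by rw [neg_lie, lie_skew, ← hyc]; rfl⟩

lemma orthogonal_le_weightFil (hκ : κ.Nondegenerate) (hκ_symm : κ.IsSymm)
    (hκ_inv : κ.lieInvariant 𝔤) (ht : IsSl2Triple h e f) (h𝔩 : IsLagrangian κ e h 𝔩)
    (hC : ∀ x ∈ C, ⁅h, x⁆ ∈ C) (hcompl : IsCompl (LinearMap.range (LieAlgebra.ad ℂ 𝔤 e)) C) :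
    κ.orthogonal (nilp h 𝔩) ≤ weightFil h 1 := by
  intro z hz
  obtain ⟨N, hN, -⟩ := exists_weight_bound ht
  obtain ⟨y, hy, c, hc, rfl⟩ := exists_decomp hκ hκ_symm hκ_inv ht h𝔩 hC hcompl (i := N) hz
    (hN ▸ Submodule.mem_top)
  exact add_mem (lie_mem_weightFil (nilp_le_weightFil h𝔩 hy.1) (e_mem_weightFil ht) (by norm_num))
    (weightFil_mono h (by norm_num) (complement_le_weightFil hκ hκ_symm hκ_inv ht hC hcompl hc))

/-- The slice is transverse to the orbits of `𝔪`. -/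
lemma eq_zero_of_lie_mem (hκ : κ.Nondegenerate) (hκ_symm : κ.IsSymm)
    (hκ_inv : κ.lieInvariant 𝔤) (ht : IsSl2Triple h e f) (h𝔩 : IsLagrangian κ e h 𝔩)
    (hC : ∀ x ∈ C, ⁅h, x⁆ ∈ C) (hcompl : IsCompl (LinearMap.range (LieAlgebra.ad ℂ 𝔤 e)) C)
    {y x : 𝔤} (hy : y ∈ nilp h 𝔩) (hx : x - e ∈ C) (hyx : ⁅y, x⁆ ∈ C) : y = 0 := by
  have key : ∀ k : ℕ, y ∈ weightFil h (-1 - k) := by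
    intro k
    induction k with
    | zero => simpa using nilp_le_weightFil h𝔩 hy
    | succ k ih =>
      have h1 := mem_weightFil_of_lie_e_mem ht hC hcompl (by omega) ih ?_
      · convert h1 using 2
        push_cast
        ring
      · have h2 : ⁅y, e⁆ = ⁅y, x⁆ + -⁅y, x - e⁆ := by
          rw [lie_sub]
          abel
        rw [h2]
        refine Submodule.add_mem_sup hyx (neg_mem (lie_mem_weightFil ih
          (complement_le_weightFil hκ hκ_symm hκ_inv ht hC hcompl hx) (by omega)))
  obtain ⟨N, -, hN⟩ := exists_weight_bound ht
  have h1 := weightFil_mono h (by omega : (-1 - N : ℤ) ≤ -N) (key N)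
  rwa [hN, Submodule.mem_bot] at h1

end Reduction

/-! ### Exponentials of nilpotent derivations -/

section Exponential

variable {𝔤 : Type*} [LieRing 𝔤] [LieAlgebra ℂ 𝔤] {κ : LinearMap.BilinForm ℂ 𝔤} {e h f : 𝔤}

lemma expAd_eq_sum {y : 𝔤} {N : ℕ} (hN : LieAlgebra.ad ℂ 𝔤 y ^ N = 0) :
    expAd y = ∑ k ∈ Finset.range N, ((k.factorial : ℂ)⁻¹) • (LieAlgebra.ad ℂ 𝔤 y) ^ k := by
  refine Finset.sum_subset (Finset.range_subset_range.2 (csInf_le' hN)) fun k _ hk => ?_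
  rw [pow_eq_zero_of_le (not_lt.1 fun hlt => hk (Finset.mem_range.2 hlt))
    (pow_nilpotencyClass ⟨N, hN⟩), smul_zero]

lemma expAd_apply {y : 𝔤} {N : ℕ} (hN : LieAlgebra.ad ℂ 𝔤 y ^ N = 0) (x : 𝔤) :
    expAd y x =
      ∑ k ∈ Finset.range N, ((k.factorial : ℂ)⁻¹) • ((LieAlgebra.ad ℂ 𝔤 y) ^ k) x := by
  simp [expAd_eq_sum hN]

lemma ad_smul_pow (a : ℂ) (y : 𝔤) (k : ℕ) :
    LieAlgebra.ad ℂ 𝔤 (a • y) ^ k = a ^ k • LieAlgebra.ad ℂ 𝔤 y ^ k := by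
  rw [map_smul, smul_pow]

lemma expAd_smul_apply {y : 𝔤} {N : ℕ} (hN : LieAlgebra.ad ℂ 𝔤 y ^ N = 0) (a : ℂ) (x : 𝔤) :
    expAd (a • y) x =
      ∑ k ∈ Finset.range N, ((k.factorial : ℂ)⁻¹ * a ^ k) • ((LieAlgebra.ad ℂ 𝔤 y) ^ k) x := by
  rw [expAd_apply (N := N) (by rw [ad_smul_pow, hN, smul_zero])]
  simp only [ad_smul_pow, LinearMap.smul_apply, mul_smul]

lemma expAd_zero_apply (x : 𝔤) : expAd (0 : 𝔤) x = x := by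
  rw [expAd_apply (N := 1) (by simp)]
  simp

lemma expAd_eq_exp [Module ℚ 𝔤] (y : 𝔤) : expAd y = IsNilpotent.exp (LieAlgebra.ad ℂ 𝔤 y) := by
  ext x
  simp only [expAd, IsNilpotent.exp, LinearMap.sum_apply, LinearMap.smul_apply]
  refine Finset.sum_congr rfl fun k _ => ?_
  rw [← Rat.cast_smul_eq_qsmul ℂ]
  simp

/-- `exp (ad y)` is an automorphism of the Lie algebra. -/
lemma expAd_lie {y : 𝔤} (hy : IsNilpotent (LieAlgebra.ad ℂ 𝔤 y)) (a b : 𝔤) :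
    expAd y ⁅a, b⁆ = ⁅expAd y a, expAd y b⁆ := by
  let : Module ℚ 𝔤 := Module.compHom 𝔤 (algebraMap ℚ ℂ)
  let _ := LieRing.toNonUnitalNonAssocRing 𝔤
  have : SMulCommClass ℂ 𝔤 𝔤 := LieAlgebra.smulCommClass ℂ 𝔤
  have : IsScalarTower ℂ 𝔤 𝔤 := LieAlgebra.isScalarTower ℂ 𝔤
  rw [expAd_eq_exp]
  exact Module.End.exp_mul_of_derivation ℂ 𝔤 (LieAlgebra.ad ℂ 𝔤 y)
    (fun a b => by
      change ⁅y, ⁅a, b⁆⁆ = ⁅a, ⁅y, b⁆⁆ + ⁅⁅y, a⁆, b⁆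
      rw [leibniz_lie, add_comm]) hy a b

lemma expAd_neg_apply {y : 𝔤} (hy : IsNilpotent (LieAlgebra.ad ℂ 𝔤 y)) (x : 𝔤) :
    expAd y (expAd (-y) x) = x := by
  let : Module ℚ 𝔤 := Module.compHom 𝔤 (algebraMap ℚ ℂ)
  rw [expAd_eq_exp, expAd_eq_exp, map_neg, ← Module.End.mul_apply,
    IsNilpotent.exp_mul_exp_neg_self hy, Module.End.one_apply]

lemma form_expAd_left (hκ_inv : κ.lieInvariant 𝔤) {y : 𝔤} (hy : IsNilpotent (LieAlgebra.ad ℂ 𝔤 y))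
    (x z : 𝔤) : κ (expAd y x) z = κ x (expAd (-y) z) := by
  obtain ⟨N, hN⟩ := hy
  have hpow : ∀ (k : ℕ) (x z : 𝔤), κ ((LieAlgebra.ad ℂ 𝔤 y ^ k) x) z =
      κ x ((LieAlgebra.ad ℂ 𝔤 (-y) ^ k) z) := by
    intro k
    induction k with
    | zero => simp
    | succ k ih =>
      intro x z
      rw [pow_succ, pow_succ', Module.End.mul_apply, Module.End.mul_apply, ih, LieAlgebra.ad_apply,
        LieAlgebra.ad_apply, hκ_inv, neg_lie, (κ x).map_neg]
  rw [expAd_apply hN, expAd_apply (N := N) (by rw [map_neg, neg_pow, hN, mul_zero])]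
  simp [map_sum, hpow]

lemma form_expAd (hκ_inv : κ.lieInvariant 𝔤) {y : 𝔤} (hy : IsNilpotent (LieAlgebra.ad ℂ 𝔤 y))
    (x z : 𝔤) : κ (expAd y x) (expAd y z) = κ x z := by
  have h1 := expAd_neg_apply (y := -y) (by rw [map_neg]; exact hy.neg) z
  rw [neg_neg] at h1
  rw [form_expAd_left hκ_inv hy, h1]

/-- The product rule for `exp (s(t) ad y) c(t)`. Since only multiples of a single `y` occur, they
commute, and no correction terms appear in the derivative of the exponential. -/
lemma HasVelocity.expAd {y : 𝔤} (hy : IsNilpotent (LieAlgebra.ad ℂ 𝔤 y)) {s : ℂ → ℂ} {s' t : ℂ}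
    (hs : HasDerivAt s s' t) {c : ℂ → 𝔤} {v : 𝔤} (hc : HasVelocity c v t) :
    HasVelocity (fun τ => expAd (s τ • y) (c τ))
      (s' • ⁅y, MVSlice.expAd (s t • y) (c t)⁆ + MVSlice.expAd (s t • y) v) t := by
  obtain ⟨N, hN⟩ := hy
  have hN1 : LieAlgebra.ad ℂ 𝔤 y ^ (N + 1) = 0 := by rw [pow_succ, hN, zero_mul]
  intro l
  set A := LieAlgebra.ad ℂ 𝔤 y with hA
  have h1 : HasDerivAt
      (fun τ => ∑ k ∈ Finset.range (N + 1), ((k.factorial : ℂ)⁻¹ * s τ ^ k) * l ((A ^ k) (c τ)))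
      (∑ k ∈ Finset.range (N + 1), (((k.factorial : ℂ)⁻¹ * (k * s t ^ (k - 1) * s')) *
        l ((A ^ k) (c t)) + ((k.factorial : ℂ)⁻¹ * s t ^ k) * l ((A ^ k) v))) t :=
    HasDerivAt.fun_sum fun k _ => ((hs.pow k).const_mul _).mul (hc (l ∘ₗ A ^ k))
  have h2 : (fun τ => l (MVSlice.expAd (s τ • y) (c τ))) = fun τ =>
      ∑ k ∈ Finset.range (N + 1), ((k.factorial : ℂ)⁻¹ * s τ ^ k) * l ((A ^ k) (c τ)) := by
    funext τ
    simp [expAd_smul_apply hN1, map_sum, hA]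
  rw [h2]
  refine h1.congr_deriv ?_
  rw [Finset.sum_add_distrib, map_add]
  congr 1
  · rw [Finset.sum_range_succ', expAd_smul_apply hN]
    simp only [Nat.cast_zero, zero_mul, mul_zero, add_zero, map_smul, map_sum, lie_sum, lie_smul,
      smul_eq_mul, Finset.mul_sum]
    refine Finset.sum_congr rfl fun k _ => ?_
    have h3 : (k.factorial : ℂ) ≠ 0 := by exact_mod_cast k.factorial_ne_zero
    have h4 : ((k : ℂ) + 1) ≠ 0 := by exact_mod_cast k.succ_ne_zero
    rw [Nat.factorial_succ, pow_succ' A, Module.End.mul_apply, hA, LieAlgebra.ad_apply]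
    push_cast
    field_simp
  · simp [expAd_smul_apply hN1, map_sum, hA]

lemma expAd_sub_sub_mem {u x : 𝔤} (hu : IsNilpotent (LieAlgebra.ad ℂ 𝔤 u)) {q : Submodule ℂ 𝔤}
    (hq : ∀ z ∈ q, ⁅u, z⁆ ∈ q) (hx : ⁅u, ⁅u, x⁆⁆ ∈ q) : expAd u x - x - ⁅u, x⁆ ∈ q := by
  obtain ⟨N, hN⟩ := hu
  have hpow : ∀ k : ℕ, (LieAlgebra.ad ℂ 𝔤 u ^ (k + 2)) x ∈ q := by
    intro k
    induction k with
    | zero => simpa [pow_two] using hx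
    | succ k ih =>
      rw [show k + 1 + 2 = (k + 2) + 1 by ring, pow_succ', Module.End.mul_apply]
      exact hq _ ih
  have h1 : expAd u x - x - ⁅u, x⁆ =
      ∑ k ∈ Finset.range N, (((k + 2).factorial : ℂ)⁻¹) • (LieAlgebra.ad ℂ 𝔤 u ^ (k + 2)) x := by
    rw [expAd_apply (N := N + 2) (by rw [pow_add, hN, zero_mul]), Finset.sum_range_succ',
      Finset.sum_range_succ']
    simp
  rw [h1]
  exact sum_mem fun k _ => q.smul_mem _ (hpow k)

lemma expAd_sub_mem {u x : 𝔤} (hu : IsNilpotent (LieAlgebra.ad ℂ 𝔤 u)) {q : Submodule ℂ 𝔤}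
    (hq : ∀ z ∈ q, ⁅u, z⁆ ∈ q) (hx : ⁅u, x⁆ ∈ q) : expAd u x - x ∈ q := by
  have := add_mem (expAd_sub_sub_mem hu hq (hq _ hx)) hx
  rwa [sub_add_cancel] at this

variable {𝔩 : Submodule ℂ 𝔤}

lemma expAd_mem_nilp (h𝔩 : IsLagrangian κ e h 𝔩) {y x : 𝔤}
    (hy : IsNilpotent (LieAlgebra.ad ℂ 𝔤 y)) (hym : y ∈ nilp h 𝔩) (hx : x ∈ nilp h 𝔩) :
    expAd y x ∈ nilp h 𝔩 := by
  have := add_mem (expAd_sub_mem hy (q := nilp h 𝔩) (fun z hz => lie_mem_nilp h𝔩 hym hz)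
    (lie_mem_nilp h𝔩 hym hx)) hx
  rwa [sub_add_cancel] at this

variable [FiniteDimensional ℂ 𝔤]

lemma isNilpotent_ad_of_weightFil (ht : IsSl2Triple h e f) {y : 𝔤} (hy : y ∈ weightFil h (-1)) :
    IsNilpotent (LieAlgebra.ad ℂ 𝔤 y) := by
  obtain ⟨N, hN, hN'⟩ := exists_weight_bound ht
  have key : ∀ (k : ℕ) (x : 𝔤), (LieAlgebra.ad ℂ 𝔤 y ^ k) x ∈ weightFil h (N - k) := by
    intro k
    induction k with
    | zero => intro x; simp [hN]
    | succ k ih =>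
      intro x
      rw [pow_succ', Module.End.mul_apply]
      exact lie_mem_weightFil hy (ih x) (by push_cast; omega)
  refine ⟨2 * N, LinearMap.ext fun x => ?_⟩
  have h1 := weightFil_mono h (by push_cast; omega : (N - (2 * N : ℕ) : ℤ) ≤ -N) (key (2 * N) x)
  rwa [hN', Submodule.mem_bot] at h1

lemma isNilpotent_ad_of_nilp (ht : IsSl2Triple h e f) (h𝔩 : IsLagrangian κ e h 𝔩) {y : 𝔤}
    (hy : y ∈ nilp h 𝔩) : IsNilpotent (LieAlgebra.ad ℂ 𝔤 y) :=
  isNilpotent_ad_of_weightFil ht (nilp_le_weightFil h𝔩 hy)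

/-- The unipotent group acts on the fibre. -/
lemma expAd_mem_momentFiber (hκ_symm : κ.IsSymm) (hκ_inv : κ.lieInvariant 𝔤)
    (ht : IsSl2Triple h e f) (h𝔩 : IsLagrangian κ e h 𝔩) {y x : 𝔤} (hy : y ∈ nilp h 𝔩)
    (hx : x ∈ momentFiber κ e (nilp h 𝔩)) : expAd y x ∈ momentFiber κ e (nilp h 𝔩) := by
  have := add_mem_momentFiber hκ_symm hx (expAd_sub_mem (isNilpotent_ad_of_nilp ht h𝔩 hy)
    (fun z hz => lie_mem_orthogonal hκ_symm hκ_inv h𝔩 hy hz)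
    (lie_mem_orthogonal_of_momentFiber hκ_symm hκ_inv ht h𝔩 hy hx))
  rwa [add_sub_cancel] at this

end Exponential

/-! ### Projections onto slices -/

section Slice

variable {𝔤 : Type*} [LieRing 𝔤] [LieAlgebra ℂ 𝔤] [FiniteDimensional ℂ 𝔤]

/-- A gauge map is a polynomial map that moves each point of the fibre inside its orbit under the
unipotent group of `𝔪`, fixes the slice `e + C`, and maps vectors tangent to orbits to vectors
tangent to orbits. Moving inside the orbit is expressed by saying that invariant functions do not
change, so that no group structure on the set of all `exp (ad y)` is needed. -/
structure IsGaugeMap (κ : LinearMap.BilinForm ℂ 𝔤) (e : 𝔤) (𝔪 C : Submodule ℂ 𝔤) (E : 𝔤 → 𝔤) :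
    Prop where
  poly : IsPolyMap E
  mapsTo : ∀ x ∈ momentFiber κ e 𝔪, E x ∈ momentFiber κ e 𝔪
  invariant : ∀ F : 𝔤 → ℂ, IsInvariantOn 𝔪 (momentFiber κ e 𝔪) F →
    ∀ x ∈ momentFiber κ e 𝔪, F (E x) = F x
  fixes : ∀ x, x - e ∈ C → E x = x
  tangent : ∀ x, ∀ y ∈ 𝔪, ∃ y' ∈ 𝔪, ∀ (c : ℂ → 𝔤) (t : ℂ), c t = x → HasVelocity c ⁅y, x⁆ t →
    HasVelocity (fun s => E (c s)) ⁅y', E x⁆ t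

/-- A polynomial retraction onto the slice `X` which is constant on the orbits in the fibre, and
whose value at a point of the fibre is a point of the same orbit. -/
structure IsSliceProjection (κ : LinearMap.BilinForm ℂ 𝔤) (e : 𝔤) (𝔪 : Submodule ℂ 𝔤) (X : Set 𝔤)
    (π : 𝔤 → 𝔤) : Prop where
  poly : IsPolyMap π
  mem : ∀ x, π x ∈ X
  fixes : ∀ x ∈ X, π x = x
  invariant : ∀ F : 𝔤 → ℂ, IsInvariantOn 𝔪 (momentFiber κ e 𝔪) F →
    ∀ x ∈ momentFiber κ e 𝔪, F (π x) = F x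
  map_expAd : ∀ y ∈ 𝔪, ∀ x ∈ momentFiber κ e 𝔪, π (expAd y x) = π x

variable {κ : LinearMap.BilinForm ℂ 𝔤} {e h f : 𝔤} {𝔩 C : Submodule ℂ 𝔤}

omit [FiniteDimensional ℂ 𝔤] in
lemma IsGaugeMap.id {𝔪 : Submodule ℂ 𝔤} : IsGaugeMap κ e 𝔪 C fun x => x where
  poly _ hF := hF
  mapsTo _ hx := hx
  invariant _ _ _ _ := rfl
  fixes _ _ := rfl
  tangent _ y hy := ⟨y, hy, fun _ _ _ hc => hc⟩

omit [FiniteDimensional ℂ 𝔤] in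
lemma IsGaugeMap.comp {𝔪 : Submodule ℂ 𝔤} {E E' : 𝔤 → 𝔤} (hE : IsGaugeMap κ e 𝔪 C E)
    (hE' : IsGaugeMap κ e 𝔪 C E') : IsGaugeMap κ e 𝔪 C fun x => E (E' x) where
  poly := hE.poly.comp hE'.poly
  mapsTo x hx := hE.mapsTo _ (hE'.mapsTo x hx)
  invariant F hF x hx := by
    rw [hE.invariant F hF _ (hE'.mapsTo x hx), hE'.invariant F hF x hx]
  fixes x hx := by rw [hE'.fixes x hx, hE.fixes x hx]
  tangent x y hy := by
    obtain ⟨y', hy', h1⟩ := hE'.tangent x y hy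
    obtain ⟨y'', hy'', h2⟩ := hE.tangent (E' x) y' hy'
    refine ⟨y'', hy'', fun c t hct hc => h2 _ t ?_ (h1 c t hct hc)⟩
    rw [hct]

/-- The map `x ↦ exp (-ℓ(x - e) ad y) x` is a gauge map. -/
lemma isGaugeMap_step (hκ_symm : κ.IsSymm) (hκ_inv : κ.lieInvariant 𝔤)
    (ht : IsSl2Triple h e f) (h𝔩 : IsLagrangian κ e h 𝔩) {y : 𝔤} (hy : y ∈ nilp h 𝔩)
    (l : Module.Dual ℂ 𝔤) (hl : ∀ c ∈ C, l c = 0) :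
    IsGaugeMap κ e (nilp h 𝔩) C fun x => expAd ((-l (x - e)) • y) x where
  poly := by
    obtain ⟨N, hN⟩ := isNilpotent_ad_of_nilp ht h𝔩 hy
    refine .of_dual fun l' => ?_
    have h1 : (fun x => l' (expAd ((-l (x - e)) • y) x)) = ∑ k ∈ Finset.range N,
        ((k.factorial : ℂ)⁻¹) • ((fun x => (-l) x + l e) ^ k *
          fun x => (l' ∘ₗ LieAlgebra.ad ℂ 𝔤 y ^ k) x) := by
      funext x
      rw [expAd_smul_apply hN, map_sum, Finset.sum_apply]
      refine Finset.sum_congr rfl fun k _ => ?_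
      simp only [map_smul, smul_eq_mul, map_sub, Pi.smul_apply, Pi.mul_apply, Pi.pow_apply,
        LinearMap.neg_apply, LinearMap.comp_apply]
      ring
    rw [h1]
    exact sum_mem fun k _ => Subalgebra.smul_mem _ (mul_mem
      (pow_mem (add_mem (dual_mem_polyFun (-l)) (const_mem_polyFun (l e))) k)
      (dual_mem_polyFun _)) _
  mapsTo x hx := expAd_mem_momentFiber hκ_symm hκ_inv ht h𝔩 (Submodule.smul_mem _ _ hy) hx
  invariant F hF x hx := hF _ (Submodule.smul_mem _ _ hy) x hx
  fixes x hx := by rw [hl _ hx, neg_zero, zero_smul, expAd_zero_apply]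
  tangent x y₀ hy₀ := by
    have hs : IsNilpotent (LieAlgebra.ad ℂ 𝔤 ((-l (x - e)) • y)) :=
      isNilpotent_ad_of_nilp ht h𝔩 (Submodule.smul_mem _ _ hy)
    refine ⟨(-l ⁅y₀, x⁆) • y + expAd ((-l (x - e)) • y) y₀,
      add_mem (Submodule.smul_mem _ _ hy)
        (expAd_mem_nilp h𝔩 hs (Submodule.smul_mem _ _ hy) hy₀), fun c t hct hc => ?_⟩
    have h1 : HasDerivAt (fun s => -l (c s - e)) (-l ⁅y₀, x⁆) t := by
      simpa only [map_sub] using ((hc l).sub_const (l e)).fun_neg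
    have h2 := HasVelocity.expAd (isNilpotent_ad_of_nilp ht h𝔩 hy) h1 hc
    rw [hct, expAd_lie hs] at h2
    rwa [add_lie, smul_lie]

/-- If a gauge map moves the fibre into `e + [𝔫, e] + C`, where the subspace `𝔫 ⊆ 𝔪` is comparable
with every step of the weight filtration of `𝔪`, then some gauge map moves the fibre into `e + C`.
One step decreases `𝔫`: with `y ∈ 𝔫` of maximal leading weight `j` and `ℓ` a functional
with `ℓ [y, e] = 1` which vanishes on `C` and on weights at most `j + 1`, the map
`x ↦ exp (-ℓ(x - e) ad y) x` removes `y` from `𝔫`. -/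
lemma exists_gaugeMap_of_le (hκ : κ.Nondegenerate) (hκ_symm : κ.IsSymm)
    (hκ_inv : κ.lieInvariant 𝔤) (ht : IsSl2Triple h e f) (h𝔩 : IsLagrangian κ e h 𝔩)
    (hC : ∀ x ∈ C, ⁅h, x⁆ ∈ C) (hcompl : IsCompl (LinearMap.range (LieAlgebra.ad ℂ 𝔤 e)) C)
    (n : ℕ) (𝔫 : Submodule ℂ 𝔤) (hn : Module.finrank ℂ 𝔫 ≤ n) (h𝔫 : 𝔫 ≤ nilp h 𝔩)
    (hcmp : ∀ i, nilp h 𝔩 ⊓ weightFil h i ≤ 𝔫 ∨ 𝔫 ≤ weightFil h i) (E : 𝔤 → 𝔤)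
    (hE : IsGaugeMap κ e (nilp h 𝔩) C E)
    (hE𝔫 : ∀ x ∈ momentFiber κ e (nilp h 𝔩), E x - e ∈ 𝔫.map (LieAlgebra.ad ℂ 𝔤 e) ⊔ C) :
    ∃ E', IsGaugeMap κ e (nilp h 𝔩) C E' ∧ ∀ x ∈ momentFiber κ e (nilp h 𝔩), E' x - e ∈ C := by
  induction n generalizing 𝔫 E with
  | zero =>
    have h0 : 𝔫 = ⊥ := Submodule.finrank_eq_zero.1 (by omega)
    exact ⟨E, hE, fun x hx => by simpa [h0] using hE𝔫 x hx⟩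
  | succ n ih =>
    by_cases h0 : 𝔫 = ⊥
    · exact ⟨E, hE, fun x hx => by simpa [h0] using hE𝔫 x hx⟩
    obtain ⟨j, hj, hjmin⟩ : ∃ j : ℤ, 𝔫 ≤ weightFil h j ∧ ∀ i, 𝔫 ≤ weightFil h i → j ≤ i := by
      obtain ⟨N, -, hN⟩ := exists_weight_bound ht
      refine Int.exists_least_of_bdd ⟨-N, fun z hz => ?_⟩
        ⟨-1, h𝔫.trans (nilp_le_weightFil h𝔩)⟩
      by_contra hlt
      exact h0 (eq_bot_iff.2 (hN ▸ hz.trans (weightFil_mono h (not_le.1 hlt).le)))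
    have hj1 : j ≤ -1 := hjmin _ (h𝔫.trans (nilp_le_weightFil h𝔩))
    have hjnot : ¬ 𝔫 ≤ weightFil h (j - 1) := fun hle => by
      have := hjmin _ hle
      omega
    have hsub := (hcmp (j - 1)).resolve_right hjnot
    obtain ⟨y, hy𝔫, hy⟩ := SetLike.not_le_iff_exists.1 hjnot
    have hye : ⁅y, e⁆ ∉ C ⊔ weightFil h (j + 1) := fun hmem =>
      hy (mem_weightFil_of_lie_e_mem ht hC hcompl (by omega) (hj hy𝔫) hmem)
    obtain ⟨l₀, hl₀, hker⟩ := Submodule.exists_le_ker_of_notMem hye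
    set l : Module.Dual ℂ 𝔤 := (l₀ ⁅y, e⁆)⁻¹ • l₀ with hl
    have hl1 : l ⁅y, e⁆ = 1 := by simp [hl, hl₀]
    have hl0 : ∀ z ∈ C ⊔ weightFil h (j + 1), l z = 0 := fun z hz => by
      have : l₀ z = 0 := hker hz
      simp [hl, this]
    have hlC : ∀ c ∈ C, l c = 0 := fun c hc => hl0 c (le_sup_left (a := C) hc)
    have hlF : ∀ z ∈ weightFil h (j + 1), l z = 0 := fun z hz => hl0 z (le_sup_right (a := C) hz)
    have hey : l ⁅e, y⁆ = -1 := by rw [← lie_skew, map_neg, hl1]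
    set 𝔫' : Submodule ℂ 𝔤 := 𝔫 ⊓ LinearMap.ker (l ∘ₗ LieAlgebra.ad ℂ 𝔤 e) with h𝔫'
    have hlt : 𝔫' < 𝔫 := by
      refine lt_of_le_of_ne inf_le_left fun heq => ?_
      have h1 : y ∈ 𝔫' := heq ▸ hy𝔫
      have h2 : l ⁅e, y⁆ = 0 := h1.2
      rw [hey] at h2
      norm_num at h2
    have hsub' : nilp h 𝔩 ⊓ weightFil h (j - 1) ≤ 𝔫' := fun z hz =>
      ⟨hsub hz, hlF _ (lie_mem_weightFil (e_mem_weightFil ht) hz.2 (by omega))⟩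
    refine ih 𝔫' (by have := Submodule.finrank_lt_finrank_of_lt hlt; omega)
      (inf_le_left.trans h𝔫) (fun i => ?_) _
      ((isGaugeMap_step hκ_symm hκ_inv ht h𝔩 (h𝔫 hy𝔫) l hlC).comp hE) fun x hx => ?_
    · rcases lt_or_ge i j with hij | hij
      · exact .inl ((inf_le_inf_left _ (weightFil_mono h (by omega))).trans hsub')
      · exact .inr (inf_le_left.trans (hj.trans (weightFil_mono h hij)))
    · have hw := hE.mapsTo x hx
      obtain ⟨_, ⟨a, ha, rfl⟩, c, hc, hac⟩ := Submodule.mem_sup.1 (hE𝔫 x hx)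
      rw [LieAlgebra.ad_apply] at hac
      set w := E x with hwdef
      have hls : l (w - e) = l ⁅e, a⁆ := by rw [← hac, map_add, hlC c hc, add_zero]
      set s := l (w - e) with hs
      have hperp : κ.orthogonal (nilp h 𝔩) ≤ weightFil h 1 :=
        orthogonal_le_weightFil hκ hκ_symm hκ_inv ht h𝔩 hC hcompl
      have hw0 : w - e ∈ κ.orthogonal (nilp h 𝔩) := (mem_momentFiber_iff hκ_symm).1 hw
      have hu𝔪 : (-s) • y ∈ nilp h 𝔩 := Submodule.smul_mem _ _ (h𝔫 hy𝔫)
      have huj : (-s) • y ∈ weightFil h j := Submodule.smul_mem _ _ (hj hy𝔫)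
      have hw2 : w ∈ weightFil h 2 := by
        rw [← sub_add_cancel w e]
        exact add_mem (weightFil_mono h (by norm_num) (hperp hw0)) (e_mem_weightFil ht)
      -- Up to weight `j + 1`, the map adds `[-s y, e]`.
      have hr1 : expAd ((-s) • y) w - w - ⁅(-s) • y, w⁆ ∈ weightFil h (j + 1) :=
        expAd_sub_sub_mem (isNilpotent_ad_of_nilp ht h𝔩 hu𝔪)
          (fun z hz => lie_mem_weightFil huj hz (by omega))
          (lie_mem_weightFil huj (lie_mem_weightFil huj hw2 le_rfl) (by omega))
      have hr2 : ⁅(-s) • y, w - e⁆ ∈ weightFil h (j + 1) :=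
        lie_mem_weightFil huj (hperp hw0) le_rfl
      have hb : a + s • y ∈ 𝔫' := by
        refine ⟨add_mem ha (Submodule.smul_mem _ _ hy𝔫), ?_⟩
        change l ⁅e, a + s • y⁆ = 0
        rw [lie_add, lie_smul, map_add, map_smul, hey, ← hls]
        simp
      have hsum : expAd ((-s) • y) w - e - ⁅e, a + s • y⁆ - c =
          (expAd ((-s) • y) w - w - ⁅(-s) • y, w⁆) + ⁅(-s) • y, w - e⁆ := by
        have h1 : ⁅e, a⁆ = w - e - c := eq_sub_of_add_eq hac
        have h2 : ⁅e, s • y⁆ = ⁅(-s) • y, e⁆ := by rw [← lie_skew, neg_smul, neg_lie]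
        rw [lie_add, h2, lie_sub, h1]
        abel
      have hZ : expAd ((-s) • y) w - e ∈ κ.orthogonal (nilp h 𝔩) :=
        (mem_momentFiber_iff hκ_symm).1 (expAd_mem_momentFiber hκ_symm hκ_inv ht h𝔩 hu𝔪 hw)
      have heZ : e ∈ momentFiber κ e (nilp h 𝔩) := fun _ _ => rfl
      have hperp_r : expAd ((-s) • y) w - e - ⁅e, a + s • y⁆ - c ∈ κ.orthogonal (nilp h 𝔩) := by
        refine sub_mem (sub_mem hZ ?_)
          (complement_le_orthogonal hκ hκ_symm hκ_inv ht h𝔩 hC hcompl hc)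
        rw [← lie_skew]
        exact neg_mem (lie_mem_orthogonal_of_momentFiber hκ_symm hκ_inv ht h𝔩 (h𝔫 hb.1) heZ)
      obtain ⟨b, hb', c', hc', hbc⟩ := exists_decomp hκ hκ_symm hκ_inv ht h𝔩 hC hcompl hperp_r
        (hsum ▸ add_mem hr1 hr2)
      rw [show j + 1 - 2 = j - 1 by ring] at hb'
      have hfin : expAd ((-s) • y) w - e = ⁅e, a + s • y + -b⁆ + (c + c') := by
        rw [lie_add, lie_neg, lie_skew, ← add_sub_cancel_right ⁅b, e⁆ c', ← hbc]
        abel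
      change expAd ((-s) • y) w - e ∈ _
      rw [hfin]
      exact Submodule.add_mem_sup ⟨_, add_mem hb (neg_mem (hsub' hb')), rfl⟩ (add_mem hc hc')

omit [FiniteDimensional ℂ 𝔤] in
lemma hasVelocity_expAd_smul {y : 𝔤} (hy : IsNilpotent (LieAlgebra.ad ℂ 𝔤 y)) (x : 𝔤) (t : ℂ) :
    HasVelocity (fun s : ℂ => expAd (s • y) x) ⁅y, expAd (t • y) x⁆ t := by
  have h1 : HasVelocity (fun _ : ℂ => x) 0 t := fun l => by
    simpa using hasDerivAt_const t (l x)
  simpa using HasVelocity.expAd hy (hasDerivAt_id t) h1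

/-- A gauge map with values in the slice is constant on orbits: the velocity of its values along a
curve in an orbit is tangent both to an orbit and to the slice, hence zero. -/
lemma IsGaugeMap.map_expAd (hκ : κ.Nondegenerate) (hκ_symm : κ.IsSymm)
    (hκ_inv : κ.lieInvariant 𝔤) (ht : IsSl2Triple h e f) (h𝔩 : IsLagrangian κ e h 𝔩)
    (hC : ∀ x ∈ C, ⁅h, x⁆ ∈ C) (hcompl : IsCompl (LinearMap.range (LieAlgebra.ad ℂ 𝔤 e)) C)
    {E : 𝔤 → 𝔤} (hE : IsGaugeMap κ e (nilp h 𝔩) C E)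
    (hEC : ∀ x ∈ momentFiber κ e (nilp h 𝔩), E x - e ∈ C) {y x : 𝔤} (hy : y ∈ nilp h 𝔩)
    (hx : x ∈ momentFiber κ e (nilp h 𝔩)) : E (expAd y x) = E x := by
  have hnil := isNilpotent_ad_of_nilp ht h𝔩 hy
  have hZ : ∀ t : ℂ, expAd (t • y) x ∈ momentFiber κ e (nilp h 𝔩) := fun t =>
    expAd_mem_momentFiber hκ_symm hκ_inv ht h𝔩 (Submodule.smul_mem _ _ hy) hx
  have hvel : ∀ t : ℂ, HasVelocity (fun s : ℂ => E (expAd (s • y) x)) 0 t := by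
    intro t
    obtain ⟨y', hy', h1⟩ := hE.tangent (expAd (t • y) x) y hy
    have h2 := h1 _ t rfl (hasVelocity_expAd_smul hnil x t)
    have h3 : ⁅y', E (expAd (t • y) x)⁆ ∈ C := by
      by_contra hne
      obtain ⟨l, hl, hker⟩ := Submodule.exists_le_ker_of_notMem hne
      have hconst : (fun s : ℂ => l (E (expAd (s • y) x))) = fun _ => l e := by
        funext s
        have : l (E (expAd (s • y) x) - e) = 0 := hker (hEC _ (hZ s))
        rwa [map_sub, sub_eq_zero] at this
      have h4 := h2 l
      rw [hconst] at h4
      exact hl (h4.unique (hasDerivAt_const t (l e)))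
    have h5 := eq_zero_of_lie_mem hκ hκ_symm hκ_inv ht h𝔩 hC hcompl hy' (hEC _ (hZ t)) h3
    rwa [h5, zero_lie] at h2
  rw [← sub_eq_zero]
  refine (Module.forall_dual_apply_eq_zero_iff ℂ _).1 fun l => ?_
  have h1 := is_const_of_deriv_eq_zero (𝕜 := ℂ) (f := fun s : ℂ => l (E (expAd (s • y) x)))
    (fun t => (hvel t l).differentiableAt) (fun t => by simpa using (hvel t l).deriv) 1 0
  simp only [one_smul, zero_smul, expAd_zero_apply] at h1
  rw [map_sub, h1, sub_self]

/-- Every MV slice is a polynomial quotient of the fibre by the unipotent group. -/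
theorem exists_sliceProjection (hκ : κ.Nondegenerate) (hκ_symm : κ.IsSymm)
    (hκ_inv : κ.lieInvariant 𝔤) (ht : IsSl2Triple h e f) (h𝔩 : IsLagrangian κ e h 𝔩)
    {X : Set 𝔤} (hX : IsMVSlice e h X) :
    X ⊆ momentFiber κ e (nilp h 𝔩) ∧ ∃ π, IsSliceProjection κ e (nilp h 𝔩) X π := by
  obtain ⟨C, hC, hcompl, rfl⟩ := hX
  have hCperp := complement_le_orthogonal hκ hκ_symm hκ_inv ht h𝔩 hC hcompl
  have hXZ : {x | x - e ∈ C} ⊆ momentFiber κ e (nilp h 𝔩) := fun x hx =>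
    (mem_momentFiber_iff hκ_symm).2 (hCperp hx)
  refine ⟨hXZ, ?_⟩
  obtain ⟨E, hE, hEC⟩ := exists_gaugeMap_of_le hκ hκ_symm hκ_inv ht h𝔩 hC hcompl _ (nilp h 𝔩)
    le_rfl le_rfl (fun i => .inl inf_le_left) _ IsGaugeMap.id fun x hx => by
      obtain ⟨N, hN, -⟩ := exists_weight_bound ht
      obtain ⟨y, hy, c, hc, hyc⟩ := exists_decomp hκ hκ_symm hκ_inv ht h𝔩 hC hcompl (i := N)
        ((mem_momentFiber_iff hκ_symm).1 hx) (hN ▸ Submodule.mem_top)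
      rw [hyc]
      exact Submodule.add_mem_sup ⟨-y, neg_mem hy.1, by simp⟩ hc
  -- Extend the restriction of `E` to the fibre by a linear projection onto `e + 𝔪^⊥`.
  obtain ⟨q, hq⟩ := (κ.orthogonal (nilp h 𝔩)).exists_isCompl
  set p : 𝔤 → 𝔤 := fun x => Submodule.projection _ _ hq x +
    (e - Submodule.projection _ _ hq e) with hp
  have hpe : ∀ x, p x - e = Submodule.projection _ _ hq (x - e) := fun x => by
    simp only [hp, map_sub]
    abel
  have hpZ : ∀ x, p x ∈ momentFiber κ e (nilp h 𝔩) := fun x => by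
    rw [mem_momentFiber_iff hκ_symm, hpe]
    exact Submodule.projection_apply_mem hq _
  have hpid : ∀ x ∈ momentFiber κ e (nilp h 𝔩), p x = x := fun x hx => by
    have h1 := hpe x
    rw [Submodule.projection_apply_of_mem_left _ ((mem_momentFiber_iff hκ_symm).1 hx)] at h1
    exact sub_left_injective h1
  refine ⟨fun x => E (p x), hE.poly.comp (isPolyMap_affine _ _), fun x => hEC _ (hpZ x),
    fun x hx => ?_, fun F hF x hx => ?_, fun y hy x hx => ?_⟩
  · rw [hpid x (hXZ hx), hE.fixes x hx]
  · rw [hpid x hx, hE.invariant F hF x hx]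
  · rw [hpid x hx, hpid _ (expAd_mem_momentFiber hκ_symm hκ_inv ht h𝔩 hy hx),
      hE.map_expAd hκ hκ_symm hκ_inv ht h𝔩 hC hcompl hEC hy hx]

end Slice

/-! ### The Kazhdan action -/

section KazhdanAction

variable {𝔤 : Type*} [LieRing 𝔤] [LieAlgebra ℂ 𝔤] [FiniteDimensional ℂ 𝔤]
  {κ : LinearMap.BilinForm ℂ 𝔤} {e h f : 𝔤} {𝔩 : Submodule ℂ 𝔤}

lemma adGamma_apply_of_weight (t : ℂˣ) {i : ℤ} {x : 𝔤} (hx : x ∈ weightSpace h i) :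
    adGamma h t x = ((t ^ i : ℂˣ) : ℂ) • x :=
  adGamma_of_mem h t i (weightSpace_le_maxGenEigenspace h i hx)

lemma adGamma_lie (ht : IsSl2Triple h e f) (t : ℂˣ) (x y : 𝔤) :
    adGamma h t ⁅x, y⁆ = ⁅adGamma h t x, adGamma h t y⁆ := by
  have h1 : ∀ i, ∀ x ∈ weightSpace h i, ∀ y, adGamma h t ⁅x, y⁆ = ⁅adGamma h t x, adGamma h t y⁆ :=
    fun i x hx y => le_of_weightSpace_le ht (p := LinearMap.eqLocus
      (adGamma h t ∘ₗ LieAlgebra.ad ℂ 𝔤 x) (LieAlgebra.ad ℂ 𝔤 (adGamma h t x) ∘ₗ adGamma h t))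
      (fun j y hy => by
        change adGamma h t ⁅x, y⁆ = ⁅adGamma h t x, adGamma h t y⁆
        rw [adGamma_apply_of_weight t hx, adGamma_apply_of_weight t hy,
          adGamma_apply_of_weight t (lie_mem_weightSpace hx hy), smul_lie, lie_smul, smul_smul,
          zpow_add, Units.val_mul]) y
  have h2 := le_of_weightSpace_le ht (p := LinearMap.eqLocus
      (adGamma h t ∘ₗ LieAlgebra.ad ℂ 𝔤 y) (LieAlgebra.ad ℂ 𝔤 (adGamma h t y) ∘ₗ adGamma h t))
      (fun i x hx => by
        change adGamma h t ⁅y, x⁆ = ⁅adGamma h t y, adGamma h t x⁆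
        rw [← lie_skew, map_neg, h1 i x hx, lie_skew]) x
  have h3 : adGamma h t ⁅y, x⁆ = ⁅adGamma h t y, adGamma h t x⁆ := h2
  rw [← lie_skew, map_neg, h3, lie_skew]

lemma adGamma_adGamma_inv (ht : IsSl2Triple h e f) (t : ℂˣ) (x : 𝔤) :
    adGamma h t (adGamma h t⁻¹ x) = x :=
  le_of_weightSpace_le ht (p := LinearMap.eqLocus (adGamma h t ∘ₗ adGamma h t⁻¹) LinearMap.id)
    (fun i x hx => by
      change adGamma h t (adGamma h t⁻¹ x) = x
      rw [adGamma_apply_of_weight _ hx, map_smul, adGamma_apply_of_weight _ hx, smul_smul,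
        ← Units.val_mul, inv_zpow, inv_mul_cancel, Units.val_one, one_smul]) x

lemma form_adGamma (hκ_inv : κ.lieInvariant 𝔤) (ht : IsSl2Triple h e f) (t : ℂˣ) (x y : 𝔤) :
    κ (adGamma h t x) (adGamma h t y) = κ x y := by
  have h1 : ∀ i, ∀ x ∈ weightSpace h i, ∀ y, κ (adGamma h t x) (adGamma h t y) = κ x y :=
    fun i x hx y => le_of_weightSpace_le ht (p := LinearMap.eqLocus
      (κ (adGamma h t x) ∘ₗ adGamma h t) (κ x))
      (fun j y hy => by
        change κ (adGamma h t x) (adGamma h t y) = κ x y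
        rw [adGamma_apply_of_weight t hx, adGamma_apply_of_weight t hy, map_smul, map_smul,
          LinearMap.smul_apply, smul_smul]
        by_cases hij : i + j = 0
        · rw [← Units.val_mul, ← zpow_add, add_comm, hij, zpow_zero, Units.val_one, one_smul]
        · rw [form_eq_zero_of_weight hκ_inv hij hx hy, smul_zero]) y
  exact le_of_weightSpace_le ht (p := LinearMap.eqLocus
    (LinearMap.flip κ (adGamma h t y) ∘ₗ adGamma h t) (LinearMap.flip κ y))
    (fun i x hx => h1 i x hx y) x

lemma kazhdan_e (ht : IsSl2Triple h e f) (t : ℂˣ) : kazhdan h t e = e := by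
  rw [kazhdan_of_mem h t 2 (e_mem_weightSpace ht)]
  simp

/-- The Kazhdan action normalizes the action of the unipotent group. -/
lemma kazhdan_expAd (ht : IsSl2Triple h e f) (t : ℂˣ) {y : 𝔤}
    (hy : IsNilpotent (LieAlgebra.ad ℂ 𝔤 y)) (x : 𝔤) :
    kazhdan h t (expAd y x) = expAd (adGamma h t⁻¹ y) (kazhdan h t x) := by
  obtain ⟨N, hN⟩ := hy
  have hpow : ∀ (k : ℕ) (z : 𝔤), (LieAlgebra.ad ℂ 𝔤 (adGamma h t⁻¹ y) ^ k) (adGamma h t⁻¹ z) =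
      adGamma h t⁻¹ ((LieAlgebra.ad ℂ 𝔤 y ^ k) z) := by
    intro k
    induction k with
    | zero => intro z; rfl
    | succ k ih =>
      intro z
      rw [pow_succ', pow_succ', Module.End.mul_apply, Module.End.mul_apply, ih,
        LieAlgebra.ad_apply, LieAlgebra.ad_apply, adGamma_lie ht]
  have hN' : LieAlgebra.ad ℂ 𝔤 (adGamma h t⁻¹ y) ^ N = 0 := LinearMap.ext fun z => by
    have h1 := adGamma_adGamma_inv ht t⁻¹ z
    rw [← h1, hpow, hN]
    simp
  simp only [kazhdan, LinearMap.smul_apply, map_smul]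
  rw [expAd_apply hN, expAd_apply hN']
  simp [map_sum, hpow]

lemma kazhdan_mem_momentFiber (hκ_inv : κ.lieInvariant 𝔤)
    (ht : IsSl2Triple h e f) (h𝔩 : IsLagrangian κ e h 𝔩) (t : ℂˣ) {x : 𝔤}
    (hx : x ∈ momentFiber κ e (nilp h 𝔩)) : kazhdan h t x ∈ momentFiber κ e (nilp h 𝔩) := by
  intro y hy
  have hm : adGamma h t y ∈ nilp h 𝔩 :=
    adGamma_mem h t _ (fun z hz => lie_h_mem_nilp h𝔩 hz) hy
  have h1 : ∀ z, κ (kazhdan h t z) y = (t : ℂ) ^ 2 * κ z (adGamma h t y) := fun z => by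
    have h2 := adGamma_adGamma_inv ht t⁻¹ y
    rw [inv_inv] at h2
    conv_lhs => rw [← h2]
    rw [kazhdan, LinearMap.smul_apply, map_smul, LinearMap.smul_apply, smul_eq_mul,
      form_adGamma hκ_inv ht]
  rw [h1, hx _ hm, ← h1, kazhdan_e ht]

end KazhdanAction

/-! ### Poisson reduction -/

section PoissonReduction

variable {𝔤 : Type*} [LieRing 𝔤] [LieAlgebra ℂ 𝔤] [FiniteDimensional ℂ 𝔤]
  {κ : LinearMap.BilinForm ℂ 𝔤} {e h f : 𝔤} {𝔩 : Submodule ℂ 𝔤}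

lemma IsInvariantOn.congr (hκ_symm : κ.IsSymm) (hκ_inv : κ.lieInvariant 𝔤)
    (ht : IsSl2Triple h e f) (h𝔩 : IsLagrangian κ e h 𝔩) {F G : 𝔤 → ℂ}
    (hF : IsInvariantOn (nilp h 𝔩) (momentFiber κ e (nilp h 𝔩)) F)
    (hFG : ∀ x ∈ momentFiber κ e (nilp h 𝔩), F x = G x) :
    IsInvariantOn (nilp h 𝔩) (momentFiber κ e (nilp h 𝔩)) G := fun y hy x hx => by
  rw [← hFG x hx, ← hFG _ (expAd_mem_momentFiber hκ_symm hκ_inv ht h𝔩 hy hx), hF y hy x hx]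

lemma lineDeriv_lie_eq_zero (ht : IsSl2Triple h e f) (h𝔩 : IsLagrangian κ e h 𝔩) {G : 𝔤 → ℂ}
    (hG : G ∈ polyFun 𝔤) (hGi : IsInvariantOn (nilp h 𝔩) (momentFiber κ e (nilp h 𝔩)) G)
    {x y : 𝔤} (hx : x ∈ momentFiber κ e (nilp h 𝔩)) (hy : y ∈ nilp h 𝔩) :
    lineDeriv ℂ G x ⁅y, x⁆ = 0 := by
  have h1 := (hasVelocity_expAd_smul (isNilpotent_ad_of_nilp ht h𝔩 hy) x 0).hasDerivAt hG
  have h2 : (fun s : ℂ => G (expAd (s • y) x)) = fun _ => G x :=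
    funext fun s => hGi _ (Submodule.smul_mem _ _ hy) x hx
  rw [h2, zero_smul, expAd_zero_apply] at h1
  exact h1.unique (hasDerivAt_const 0 (G x))

/-- The gradient of a function vanishing on the fibre `e + 𝔪^⊥` lies in `𝔪`. -/
lemma gradient_mem_nilp (hκ : κ.Nondegenerate) (hκ_symm : κ.IsSymm) {A : 𝔤 → ℂ}
    (hA : A ∈ polyFun 𝔤) {𝔪 : Submodule ℂ 𝔤} (hA0 : ∀ x ∈ momentFiber κ e 𝔪, A x = 0) {x : 𝔤}
    (hx : x ∈ momentFiber κ e 𝔪) : gradient κ hκ A x ∈ 𝔪 := by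
  rw [← LinearMap.BilinForm.orthogonal_orthogonal hκ hκ_symm.isRefl 𝔪,
    mem_orthogonal_iff_form hκ_symm]
  intro w hw
  rw [gradient_spec κ hκ hA]
  have h1 : (fun t : ℂ => A (x + t • w)) = fun _ => 0 :=
    funext fun t => hA0 _ (add_mem_momentFiber hκ_symm hx (Submodule.smul_mem _ _ hw))
  rw [lineDeriv, h1, deriv_const]

/-- On the fibre, functions vanishing there have zero bracket with invariant functions: the
Hamiltonian vector field of such a function is tangent to the orbits. -/
lemma kksBracket_eq_zero_of_vanish (hκ : κ.Nondegenerate) (hκ_symm : κ.IsSymm)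
    (hκ_inv : κ.lieInvariant 𝔤) (ht : IsSl2Triple h e f) (h𝔩 : IsLagrangian κ e h 𝔩) {A G : 𝔤 → ℂ}
    (hA : A ∈ polyFun 𝔤) (hA0 : ∀ x ∈ momentFiber κ e (nilp h 𝔩), A x = 0)
    (hG : G ∈ polyFun 𝔤) (hGi : IsInvariantOn (nilp h 𝔩) (momentFiber κ e (nilp h 𝔩)) G)
    {x : 𝔤} (hx : x ∈ momentFiber κ e (nilp h 𝔩)) : kksBracket κ hκ A G x = 0 := by
  have h1 := lineDeriv_lie_eq_zero ht h𝔩 hG hGi hx (gradient_mem_nilp hκ hκ_symm hA hA0 hx)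
  rw [← gradient_spec κ hκ hG] at h1
  rw [kksBracket, ← lieInvariant_left hκ_inv, form_comm hκ_symm, ← lie_skew, map_neg, h1, neg_zero]

/-- On the fibre, the bracket of invariant functions depends only on their restrictions to
the fibre. -/
lemma kks_congr (hκ : κ.Nondegenerate) (hκ_symm : κ.IsSymm)
    (hκ_inv : κ.lieInvariant 𝔤) (ht : IsSl2Triple h e f) (h𝔩 : IsLagrangian κ e h 𝔩)
    {F F' G G' : polyFun 𝔤} (hF : IsInvariantOn (nilp h 𝔩) (momentFiber κ e (nilp h 𝔩)) F)
    (hG : IsInvariantOn (nilp h 𝔩) (momentFiber κ e (nilp h 𝔩)) G)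
    (hFF' : ∀ x ∈ momentFiber κ e (nilp h 𝔩), (F : 𝔤 → ℂ) x = (F' : 𝔤 → ℂ) x)
    (hGG' : ∀ x ∈ momentFiber κ e (nilp h 𝔩), (G : 𝔤 → ℂ) x = (G' : 𝔤 → ℂ) x)
    {x : 𝔤} (hx : x ∈ momentFiber κ e (nilp h 𝔩)) :
    kksBracket κ hκ F G x = kksBracket κ hκ F' G' x := by
  have hG' := hG.congr hκ_symm hκ_inv ht h𝔩 hGG'
  have h1 : (kks κ hκ (F - F') G' : 𝔤 → ℂ) x = 0 :=
    kksBracket_eq_zero_of_vanish hκ hκ_symm hκ_inv ht h𝔩 (F - F').2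
      (fun x hx => sub_eq_zero.2 (hFF' x hx)) G'.2 hG' hx
  have h2 : (kks κ hκ (G - G') F : 𝔤 → ℂ) x = 0 :=
    kksBracket_eq_zero_of_vanish hκ hκ_symm hκ_inv ht h𝔩 (G - G').2
      (fun x hx => sub_eq_zero.2 (hGG' x hx)) F.2 hF hx
  have hskew : ∀ A B : polyFun 𝔤, kksBracket κ hκ A B x = - kksBracket κ hκ B A x := fun A B => by
    rw [kksBracket, kksBracket, ← lie_skew, map_neg]
  simp only [map_sub, LinearMap.sub_apply, AddSubgroupClass.coe_sub, Pi.sub_apply, kks_apply] at h1 h2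
  rw [hskew G F, hskew G' F] at h2
  linear_combination h1 - h2

/-- The unipotent group acts by Poisson automorphisms. -/
lemma kksBracket_expAd (hκ : κ.Nondegenerate) (hκ_inv : κ.lieInvariant 𝔤) {y : 𝔤}
    (hy : IsNilpotent (LieAlgebra.ad ℂ 𝔤 y)) {F G : 𝔤 → ℂ} (hF : F ∈ polyFun 𝔤)
    (hG : G ∈ polyFun 𝔤) (x : 𝔤) :
    kksBracket κ hκ F G (expAd y x) =
      kksBracket κ hκ (fun z => F (expAd y z)) (fun z => G (expAd y z)) x := by
  have hgrad : ∀ F ∈ polyFun 𝔤, gradient κ hκ F (expAd y x) =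
      expAd y (gradient κ hκ (fun z => F (expAd y z)) x) := by
    intro F hF
    refine eq_gradient κ hκ hF fun w => ?_
    have hFg : (fun z => F (expAd y z)) ∈ polyFun 𝔤 := by
      simpa using isPolyMap_affine (expAd y) 0 F hF
    have h1 : lineDeriv ℂ (fun z => F (expAd y z)) x (expAd (-y) w) =
        lineDeriv ℂ F (expAd y x) w := by
      simp only [lineDeriv, map_add, map_smul, expAd_neg_apply hy]
    rw [← h1, ← gradient_spec κ hκ hFg, form_expAd_left hκ_inv hy]
  rw [kksBracket, kksBracket, hgrad F hF, hgrad G hG, ← expAd_lie hy, form_expAd hκ_inv hy]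

lemma isInvariantOn_kksBracket (hκ : κ.Nondegenerate) (hκ_symm : κ.IsSymm)
    (hκ_inv : κ.lieInvariant 𝔤) (ht : IsSl2Triple h e f) (h𝔩 : IsLagrangian κ e h 𝔩)
    {F G : polyFun 𝔤} (hF : IsInvariantOn (nilp h 𝔩) (momentFiber κ e (nilp h 𝔩)) F)
    (hG : IsInvariantOn (nilp h 𝔩) (momentFiber κ e (nilp h 𝔩)) G) :
    IsInvariantOn (nilp h 𝔩) (momentFiber κ e (nilp h 𝔩)) (kksBracket κ hκ F G) := by
  intro y hy x hx
  have hpoly : ∀ F : polyFun 𝔤, (fun z => (F : 𝔤 → ℂ) (expAd y z)) ∈ polyFun 𝔤 := fun F => by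
    simpa using isPolyMap_affine (expAd y) 0 F F.2
  rw [kksBracket_expAd hκ hκ_inv (isNilpotent_ad_of_nilp ht h𝔩 hy) F.2 G.2]
  exact (kks_congr hκ hκ_symm hκ_inv ht h𝔩 (F' := ⟨_, hpoly F⟩) (G' := ⟨_, hpoly G⟩) hF hG
    (fun z hz => (hF y hy z hz).symm) (fun z hz => (hG y hy z hz).symm) hx).symm

/-- Restriction to a subset as a linear map. -/
def resLinear (X : Set 𝔤) : polyFun 𝔤 →ₗ[ℂ] coordRing X where
  toFun := res X
  map_add' _ _ := rfl
  map_smul' _ _ := rfl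

variable {X : Set 𝔤} {π : 𝔤 → 𝔤}

/-- The extension of regular functions on the slice to polynomial functions on `𝔤` whose
restrictions to the fibre are invariant, by composition with a slice projection. -/
def sliceLift (hπ : IsSliceProjection κ e (nilp h 𝔩) X π) : coordRing X →ₐ[ℂ] polyFun 𝔤 where
  toFun a := ⟨fun x => (a : X → ℂ) ⟨π x, hπ.mem x⟩, by
    obtain ⟨_, F, hF, rfl⟩ := a
    exact hπ.poly F hF⟩
  map_one' := rfl
  map_mul' _ _ := rfl
  map_zero' := rfl
  map_add' _ _ := rfl
  commutes' _ := rfl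

variable (hπ : IsSliceProjection κ e (nilp h 𝔩) X π)

include hπ

omit [FiniteDimensional ℂ 𝔤] in
lemma isInvariantOn_sliceLift (a : coordRing X) :
    IsInvariantOn (nilp h 𝔩) (momentFiber κ e (nilp h 𝔩)) (sliceLift hπ a) := fun y hy x hx => by
  exact congrArg (a : X → ℂ) (Subtype.ext (hπ.map_expAd y hy x hx))

omit [FiniteDimensional ℂ 𝔤] in
lemma res_sliceLift (a : coordRing X) : res X (sliceLift hπ a) = a :=
  Subtype.ext <| funext fun x => by
    exact congrArg (a : X → ℂ) (Subtype.ext (hπ.fixes x x.2))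

omit [FiniteDimensional ℂ 𝔤] in
lemma sliceLift_res {F : polyFun 𝔤} (hF : IsInvariantOn (nilp h 𝔩) (momentFiber κ e (nilp h 𝔩)) F)
    {x : 𝔤} (hx : x ∈ momentFiber κ e (nilp h 𝔩)) :
    (F : 𝔤 → ℂ) x = (sliceLift hπ (res X F) : 𝔤 → ℂ) x :=
  (hπ.invariant F hF x hx).symm

lemma res_kks_sliceLift (hκ : κ.Nondegenerate) (hκ_symm : κ.IsSymm)
    (hκ_inv : κ.lieInvariant 𝔤) (ht : IsSl2Triple h e f) (h𝔩 : IsLagrangian κ e h 𝔩)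
    (hXZ : X ⊆ momentFiber κ e (nilp h 𝔩)) {F G : polyFun 𝔤}
    (hF : IsInvariantOn (nilp h 𝔩) (momentFiber κ e (nilp h 𝔩)) F)
    (hG : IsInvariantOn (nilp h 𝔩) (momentFiber κ e (nilp h 𝔩)) G) :
    res X (kks κ hκ (sliceLift hπ (res X F)) (sliceLift hπ (res X G))) = res X (kks κ hκ F G) :=
  Subtype.ext <| funext fun x => (kks_congr hκ hκ_symm hκ_inv ht h𝔩 hF hG
    (fun _ hz => sliceLift_res hπ hF hz) (fun _ hz => sliceLift_res hπ hG hz) (hXZ x.2)).symm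

/-- The reduced Poisson bracket: the restriction to the slice of the bracket of the
invariant extensions. -/
def reducedBracket (hκ : κ.Nondegenerate) (hκ_symm : κ.IsSymm)
    (hκ_inv : κ.lieInvariant 𝔤) (ht : IsSl2Triple h e f) (h𝔩 : IsLagrangian κ e h 𝔩)
    (hXZ : X ⊆ momentFiber κ e (nilp h 𝔩)) : PoissonBracket (coordRing X) where
  bracket := LinearMap.mk₂ ℂ (fun a b => resLinear X (kks κ hκ (sliceLift hπ a) (sliceLift hπ b)))
    (fun a a' b => by simp only [map_add, LinearMap.add_apply])
    (fun r a b => by simp only [map_smul, LinearMap.smul_apply])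
    (fun a b b' => by simp only [map_add])
    (fun r a b => by simp only [map_smul])
  bracket_self a := by simp [kks_self]
  jacobi a b c := by
    have hnest : ∀ a b c : coordRing X,
        resLinear X (kks κ hκ (sliceLift hπ a)
          (sliceLift hπ (resLinear X (kks κ hκ (sliceLift hπ b) (sliceLift hπ c))))) =
        resLinear X (kks κ hκ (sliceLift hπ a) (kks κ hκ (sliceLift hπ b) (sliceLift hπ c))) := by
      intro a b c
      have h1 := res_kks_sliceLift hπ hκ hκ_symm hκ_inv ht h𝔩 hXZ (isInvariantOn_sliceLift hπ a)
        (G := kks κ hκ (sliceLift hπ b) (sliceLift hπ c))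
        (isInvariantOn_kksBracket hκ hκ_symm hκ_inv ht h𝔩 (isInvariantOn_sliceLift hπ b)
          (isInvariantOn_sliceLift hπ c))
      rw [res_sliceLift] at h1
      exact h1
    simp only [LinearMap.mk₂_apply, hnest]
    rw [← map_add, ← map_add, kks_jacobi κ hκ hκ_symm, map_zero]
  leibniz a b c := by
    have hmul : ∀ F G : polyFun 𝔤, resLinear X (F * G) = res X F * res X G := fun _ _ => rfl
    simp only [LinearMap.mk₂_apply, map_mul, kks_mul, map_add, hmul, res_sliceLift]
    rfl

lemma isHamiltonianReduction_reducedBracket (hκ : κ.Nondegenerate) (hκ_symm : κ.IsSymm)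
    (hκ_inv : κ.lieInvariant 𝔤) (ht : IsSl2Triple h e f) (h𝔩 : IsLagrangian κ e h 𝔩)
    (hXZ : X ⊆ momentFiber κ e (nilp h 𝔩)) :
    IsHamiltonianReduction κ hκ e (nilp h 𝔩) X
      (reducedBracket hπ hκ hκ_symm hκ_inv ht h𝔩 hXZ) where
  subset := hXZ
  injective F G hF hG hFG := Subtype.ext <| funext fun x => by
    change (F : 𝔤 → ℂ) x = (G : 𝔤 → ℂ) x
    rw [sliceLift_res hπ hF x.2, sliceLift_res hπ hG x.2, hFG]
  surjective a := ⟨sliceLift hπ a, isInvariantOn_sliceLift hπ a, res_sliceLift hπ a⟩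
  invariant_bracket F G hF hG := isInvariantOn_kksBracket hκ hκ_symm hκ_inv ht h𝔩 hF hG
  bracket_eq F G hF hG x := congrFun (congrArg Subtype.val
    (res_kks_sliceLift hπ hκ hκ_symm hκ_inv ht h𝔩 hXZ hF hG)) x

omit hπ in
lemma IsHamiltonianReduction.unique {hκ : κ.Nondegenerate} {𝔪 : Submodule ℂ 𝔤}
    {P P' : PoissonBracket (coordRing X)} (hP : IsHamiltonianReduction κ hκ e 𝔪 X P)
    (hP' : IsHamiltonianReduction κ hκ e 𝔪 X P') : P = P' := by
  have h1 : P.bracket = P'.bracket := LinearMap.ext fun a => LinearMap.ext fun b => by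
    obtain ⟨F, hF, rfl⟩ := hP.surjective a
    obtain ⟨G, hG, rfl⟩ := hP.surjective b
    refine Subtype.ext <| funext fun x => ?_
    rw [hP.bracket_eq F G hF hG, hP'.bracket_eq F G hF hG]
  cases P
  cases P'
  congr

omit hπ in
/-- Hamiltonian reduction induces a unique Poisson structure on every MV slice. -/
theorem existsUnique_isHamiltonianReduction (hκ : κ.Nondegenerate) (hκ_symm : κ.IsSymm)
    (hκ_inv : κ.lieInvariant 𝔤) (ht : IsSl2Triple h e f) (h𝔩 : IsLagrangian κ e h 𝔩)
    (hX : IsMVSlice e h X) :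
    ∃! P : PoissonBracket (coordRing X), IsHamiltonianReduction κ hκ e (nilp h 𝔩) X P := by
  obtain ⟨hXZ, π, hπ⟩ := exists_sliceProjection hκ hκ_symm hκ_inv ht h𝔩 hX
  have hP := isHamiltonianReduction_reducedBracket hπ hκ hκ_symm hκ_inv ht h𝔩 hXZ
  exact ⟨_, hP, fun P' hP' => hP'.unique hP⟩

omit [FiniteDimensional ℂ 𝔤] in
lemma IsSliceProjection.isInvariantOn_dual (l : Module.Dual ℂ 𝔤) :
    IsInvariantOn (nilp h 𝔩) (momentFiber κ e (nilp h 𝔩)) (fun x => l (π x)) :=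
  fun y hy x hx => congrArg l (hπ.map_expAd y hy x hx)

omit [FiniteDimensional ℂ 𝔤] in
/-- A slice projection takes the same value at `x` and at the projection of `x` to
another slice. -/
lemma IsSliceProjection.comp_eq {X' : Set 𝔤} {π' : 𝔤 → 𝔤}
    (hπ' : IsSliceProjection κ e (nilp h 𝔩) X' π') {x : 𝔤}
    (hx : x ∈ momentFiber κ e (nilp h 𝔩)) : π (π' x) = π x := by
  rw [← sub_eq_zero]
  refine (Module.forall_dual_apply_eq_zero_iff ℂ _).1 fun l => ?_
  rw [map_sub, sub_eq_zero]
  exact hπ'.invariant _ (hπ.isInvariantOn_dual l) x hx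

/-- Slice projections commute with the Kazhdan action: it preserves the slice and permutes
the orbits. -/
lemma IsSliceProjection.kazhdan (hκ_inv : κ.lieInvariant 𝔤) (ht : IsSl2Triple h e f)
    (h𝔩 : IsLagrangian κ e h 𝔩) (hX : IsMVSlice e h X) (t : ℂˣ) {x : 𝔤}
    (hx : x ∈ momentFiber κ e (nilp h 𝔩)) :
    π (MVSlice.kazhdan h t x) = MVSlice.kazhdan h t (π x) := by
  rw [← hπ.fixes _ (kazhdan_mem ht hX t (hπ.mem x)), eq_comm, ← sub_eq_zero]
  refine (Module.forall_dual_apply_eq_zero_iff ℂ _).1 fun l => ?_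
  rw [map_sub, sub_eq_zero]
  refine hπ.invariant (fun z => l (π (MVSlice.kazhdan h t z))) (fun y hy z hz => ?_) x hx
  have hy' : adGamma h t⁻¹ y ∈ nilp h 𝔩 :=
    adGamma_mem h _ _ (fun z hz => lie_h_mem_nilp h𝔩 hz) hy
  change l (π (MVSlice.kazhdan h t (expAd y z))) = l (π (MVSlice.kazhdan h t z))
  rw [kazhdan_expAd ht t (isNilpotent_ad_of_nilp ht h𝔩 hy),
    hπ.map_expAd _ hy' _ (kazhdan_mem_momentFiber hκ_inv ht h𝔩 t hz)]

end PoissonReduction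

section Comparison

variable {𝔤 : Type*} [LieRing 𝔤] [LieAlgebra ℂ 𝔤] [FiniteDimensional ℂ 𝔤]
  {κ : LinearMap.BilinForm ℂ 𝔤} {e h f : 𝔤} {𝔩 : Submodule ℂ 𝔤} {X₁ X₂ : Set 𝔤} {π₁ π₂ : 𝔤 → 𝔤}
  (hπ₁ : IsSliceProjection κ e (nilp h 𝔩) X₁ π₁) (hπ₂ : IsSliceProjection κ e (nilp h 𝔩) X₂ π₂)

/-- The comparison isomorphism between two slices, given by moving points along orbits. -/
def sliceEquiv (hX₁ : X₁ ⊆ momentFiber κ e (nilp h 𝔩)) (hX₂ : X₂ ⊆ momentFiber κ e (nilp h 𝔩)) :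
    X₁ ≃ X₂ where
  toFun x := ⟨π₂ x, hπ₂.mem x⟩
  invFun x := ⟨π₁ x, hπ₁.mem x⟩
  left_inv x := Subtype.ext ((hπ₁.comp_eq hπ₂ (hX₁ x.2)).trans (hπ₁.fixes x x.2))
  right_inv x := Subtype.ext ((hπ₂.comp_eq hπ₁ (hX₂ x.2)).trans (hπ₂.fixes x x.2))

omit [FiniteDimensional ℂ 𝔤] in
include hπ₂ in
lemma isRegularMap_slice : IsRegularMap (X := X₁) (Y := X₂) fun x => ⟨π₂ x, hπ₂.mem x⟩ := by
  rintro _ ⟨F, hF, rfl⟩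
  exact ⟨fun x => F (π₂ x), hπ₂.poly F hF, rfl⟩

lemma isPoissonIso_sliceEquiv {hκ : κ.Nondegenerate} {P₁ : PoissonBracket (coordRing X₁)}
    {P₂ : PoissonBracket (coordRing X₂)} (hP₁ : IsHamiltonianReduction κ hκ e (nilp h 𝔩) X₁ P₁)
    (hP₂ : IsHamiltonianReduction κ hκ e (nilp h 𝔩) X₂ P₂) :
    IsPoissonIso P₁ P₂ (sliceEquiv hπ₁ hπ₂ hP₁.subset hP₂.subset) where
  regular := isRegularMap_slice hπ₂
  regular_symm := isRegularMap_slice hπ₁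
  map_bracket a b := by
    have hpull : ∀ F : polyFun 𝔤, IsInvariantOn (nilp h 𝔩) (momentFiber κ e (nilp h 𝔩)) F →
        pullback (isRegularMap_slice (X₁ := X₁) hπ₂) (res X₂ F) = res X₁ F := fun F hF =>
      Subtype.ext <| funext fun x => hπ₂.invariant F hF x (hP₁.subset x.2)
    obtain ⟨F, hF, rfl⟩ := hP₂.surjective a
    obtain ⟨G, hG, rfl⟩ := hP₂.surjective b
    refine Subtype.ext <| funext fun x => ?_
    change (P₂.bracket (res X₂ F) (res X₂ G) : X₂ → ℂ) ⟨π₂ x, hπ₂.mem x⟩ =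
      (P₁.bracket (pullback (isRegularMap_slice (X₁ := X₁) hπ₂) (res X₂ F))
        (pullback (isRegularMap_slice (X₁ := X₁) hπ₂) (res X₂ G)) : X₁ → ℂ) x
    rw [hpull F hF, hpull G hG, hP₁.bracket_eq F G hF hG, hP₂.bracket_eq F G hF hG]
    exact hπ₂.invariant _ (hP₁.invariant_bracket F G hF hG) x (hP₁.subset x.2)

end Comparison

end MVSlice

end

theorem theorem5p3 {𝔤 : Type*} [LieRing 𝔤] [LieAlgebra ℂ 𝔤] [FiniteDimensional ℂ 𝔤]
    [LieAlgebra.HasCentralRadical ℂ 𝔤]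
    (κ : LinearMap.BilinForm ℂ 𝔤) (hκ : κ.Nondegenerate) (hκ_symm : κ.IsSymm)
    (hκ_inv : κ.lieInvariant 𝔤)
    {e h f : 𝔤} (ht : IsSl2Triple h e f)
    (𝔩 : Submodule ℂ 𝔤) (h𝔩 : MVSlice.IsLagrangian κ e h 𝔩)
    {X₁ X₂ : Set 𝔤} (hX₁ : MVSlice.IsMVSlice e h X₁) (hX₂ : MVSlice.IsMVSlice e h X₂) :
    (∃! P₁ : MVSlice.PoissonBracket (MVSlice.coordRing X₁),
      MVSlice.IsHamiltonianReduction κ hκ e (MVSlice.nilp h 𝔩) X₁ P₁) ∧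
    (∃! P₂ : MVSlice.PoissonBracket (MVSlice.coordRing X₂),
      MVSlice.IsHamiltonianReduction κ hκ e (MVSlice.nilp h 𝔩) X₂ P₂) ∧
    ∃ φ : X₁ ≃ X₂,
      (∀ (t : ℂˣ) (x : X₁),
        φ (MVSlice.kazhdanOn ht hX₁ t x) = MVSlice.kazhdanOn ht hX₂ t (φ x)) ∧
      ∀ (P₁ : MVSlice.PoissonBracket (MVSlice.coordRing X₁))
        (P₂ : MVSlice.PoissonBracket (MVSlice.coordRing X₂)),
        MVSlice.IsHamiltonianReduction κ hκ e (MVSlice.nilp h 𝔩) X₁ P₁ →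
        MVSlice.IsHamiltonianReduction κ hκ e (MVSlice.nilp h 𝔩) X₂ P₂ →
        MVSlice.IsPoissonIso P₁ P₂ φ := by
  obtain ⟨hZ₁, π₁, hπ₁⟩ := MVSlice.exists_sliceProjection hκ hκ_symm hκ_inv ht h𝔩 hX₁
  obtain ⟨hZ₂, π₂, hπ₂⟩ := MVSlice.exists_sliceProjection hκ hκ_symm hκ_inv ht h𝔩 hX₂
  exact ⟨MVSlice.existsUnique_isHamiltonianReduction hκ hκ_symm hκ_inv ht h𝔩 hX₁,
    MVSlice.existsUnique_isHamiltonianReduction hκ hκ_symm hκ_inv ht h𝔩 hX₂,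
    MVSlice.sliceEquiv hπ₁ hπ₂ hZ₁ hZ₂,
    fun t x => Subtype.ext (hπ₂.kazhdan hκ_inv ht h𝔩 hX₂ t (hZ₁ x.2)),
    fun P₁ P₂ hP₁ hP₂ => MVSlice.isPoissonIso_sliceEquiv hπ₁ hπ₂ hP₁ hP₂⟩
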